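/- **Setting.** A study consists of $I\ge 1$ matched sets; set $i$ has $n_i\ge 1$ subjects, $N=\sum_{i=1}^I n_i$, and fixed ordered doses $z_{i(1)}\le\dots\le z_{i(n_i)}$. Subject $ij$ has a fixed potential outcome function $r_{ij}(\cdot)$; write $r_{ij}^{(k)}=r_{ij}(z_{i(k)})$. For prespecified functions $f_i^{(k)}$ the estimand is $$\theta=\sum_{i=1}^I\frac{n_i}{N}\theta_i,\qquad \theta_i=\frac1{n_i}\sum_{j=1}^{n_i}\sum_{k=1}^{n_i} f_i^{(k)}(z_{i(k)},r_{ij}^{(k)}).$$ A dose assignment is a tuple of permutations $\pi=(\pi_1,\dots,\pi_I)$, $\pi_i\in S_{n_i}$: subject $ij$ receives dose $Z_{ij}=z_{i(\pi_i(j))}$ and has observed outcome $R_{ij}=r_{ij}(Z_{ij})$ (permutations that differ only by swapping tied doses are treated as different). Under the Rosenbaum dose model with sensitivity parameter $\Gamma=e^{\gamma}$, $\gamma\ge 0$, and unmeasured confounders $\mathbf u\in[0,1]^N$, the assignments are independent across sets and $$P_{\mathbf u}(\pi)=\prod_{i=1}^I\frac{\exp\{\gamma\sum_j z_{i(\pi_i(j))}u_{ij}\}}{\sum_{\tau\in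 S_{n_i}}\exp\{\gamma\sum_j z_{i(\tau(j))}u_{ij}\}};$$ $E_{\mathbf u}$ and $\mathrm{Var}_{\mathbf u}$ refer to this law. **Test.** Let $V_{N,i}=\sum_{j}\sum_{k} f_i^{(k)}(Z_{ij},R_{ij})\,\mathbb 1\{\pi_i(j)=k\}$ (for distinct doses the indicator is $\mathbb 1\{Z_{ij}=z_{i(k)}\}$), and $$\Gamma_i^p=\exp\Big\{\gamma\Big(\sum_{k=\lceil n_i/2\rceil+1}^{n_i}z_{i(k)}-\sum_{k=1}^{\lfloor n_i/2\rfloor}z_{i(k)}\Big)\Big\},$$ $$V_{C,\Gamma,\theta_0,i}=V_{N,i}-\theta_0-\frac{\Gamma_i^p-1}{1+\Gamma_i^p}|V_{N,i}-\theta_0|,\qquad V_{C,\Gamma,\theta_0}=\sum_{i=1}^I\frac{n_i}{N}V_{C,\Gamma,\theta_0,i}.$$ Let $Q$ be a fixed $I\times L$ matrix of full column rank, $L<I$, with hat matrix $H_Q=Q(Q^TQ)^{-1}Q^T$ and diagonal entries $h_{ii}$; let $w_i=In_i/N$, $W=\mathrm{diag}(w_1,\dots,w_I)$, $y_i=V_{C,\Gamma,\theta_0,i}/\sqrt{1-h_{ii}}$,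 $\mathbf y=(y_1,\dots,y_I)$, $$S^2_{C,\Gamma,\theta_0}(Q)=I^{-2}\,\mathbf y\,W(\mathcal I-H_Q)W\,\mathbf y^T,\qquad \overline p_{C,\Gamma,\theta_0}=1-\Phi\big(V_{C,\Gamma,\theta_0}/S_{C,\Gamma,\theta_0}(Q)\big),$$ where $\mathcal I$ is the identity matrix and $\Phi$ is the standard normal distribution function. **Condition on $\mathbf u$.** There is $\mathbf u'\in[0,1]^N$ such that $E_{\mathbf u}(V_{C,\Gamma,\theta_0})\le E_{\mathbf u'}(V_{C,\Gamma,\theta_0})$ and $$\sum_{i=1}^I\frac{n_i}{N}\frac{\Gamma_i^p-1}{1+\Gamma_i^p}E_{\mathbf u'}|V_{N,i}-\theta_i|\le\sum_{i=1}^I\frac{n_i}{N}\frac{\Gamma_i^p-1}{1+\Gamma_i^p}E_{\mathbf u'}|V_{N,i}-\theta|.$$ **Theorem.** Fix $\gamma\ge0$, $\theta_0\in\mathbb R$, constants $\delta,c>0$ and $C\in\mathbb R$, and a sequence of studies with matrices $Q$ as above such that $I\to\infty$, the weak null $\theta=\theta_0$ holds in every study, and $\max_i h_{ii}\le 1-\delta$.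 Let $0<\alpha\le 1/2$. Then for every $\varepsilon>0$, for all sufficiently late studies in the sequence, $$P_{\mathbf u}\big[\overline p_{C,\Gamma,\theta_0}\le\alpha\big]\le\alpha+\varepsilon$$ simultaneously for all $\mathbf u\in[0,1]^N$ that satisfy the Condition and the moment bounds $$\frac1I\sum_{i=1}^I w_i^4\,E_{\mathbf u}\big(V_{C,\Gamma,\theta_0,i}^4\big)\le C,\qquad I\,\mathrm{Var}_{\mathbf u}(V_{C,\Gamma,\theta_0})\ge c.$$ In particular, $\limsup P_{\mathbf u}[\overline p_{C,\Gamma,\theta_0}\le\alpha]\le\alpha$ along every sequence of such $\mathbf u$. -/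

import Mathlib

noncomputable section

/-- A finite population of matched sets with treatment doses, everything in it being fixed
(non-random): `z i k` is the order statistic `z_{i(k+1)}` of the doses of set `i`, `r i j` is
the potential outcome function `r_{ij}(·)` of subject `ij`, and `f i k` is the prespecified
function `f_i^{(k+1)}(z, r)` that defines the estimand. -/
structure DoseStudy where
  /-- number of matched sets -/
  I : ℕ
  /-- size of each matched set -/
  n : Fin I → ℕ
  n_pos : ∀ i, 1 ≤ n i
  z : (i : Fin I) → Fin (n i) → ℝ
  z_mono : ∀ i, Monotone (z i)
  r : (i : Fin I) → Fin (n i) → ℝ → ℝ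
  f : (i : Fin I) → Fin (n i) → ℝ → ℝ → ℝ

namespace DoseStudy

variable (S : DoseStudy)

/-- Dose assignments: subject `ij` receives the ordered dose number `π i j`.
Permutations that differ by swapping tied doses count as different. -/
abbrev Assignment : Type := (i : Fin S.I) → Equiv.Perm (Fin (S.n i))

/-- Vectors of one real number per subject. -/
abbrev Confounder : Type := (i : Fin S.I) → Fin (S.n i) → ℝ

/-- The vector `u` lies in `[0,1]^N`. -/
def Normalized (u : S.Confounder) : Prop := ∀ i j, 0 ≤ u i j ∧ u i j ≤ 1

/-- Total number of subjects `N`. -/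
def N : ℕ := ∑ i, S.n i

/-- `θ_i = n_i⁻¹ ∑_j ∑_k f_i^{(k)}(z_{i(k)}, r_{ij}(z_{i(k)}))`. -/
def thetaSet (i : Fin S.I) : ℝ :=
  (S.n i : ℝ)⁻¹ * ∑ j, ∑ k, S.f i k (S.z i k) (S.r i j (S.z i k))

/-- The estimand `θ = ∑_i (n_i / N) θ_i`. -/
def theta : ℝ := ∑ i, (S.n i : ℝ) / S.N * S.thetaSet i

/-- Rosenbaum dose model within set `i`: the probability of the permutation `σ`. -/
def setProb (γ : ℝ) (u : S.Confounder) (i : Fin S.I) (σ : Equiv.Perm (Fin (S.n i))) : ℝ :=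
  Real.exp (γ * ∑ j, S.z i (σ j) * u i j) /
    ∑ τ : Equiv.Perm (Fin (S.n i)), Real.exp (γ * ∑ j, S.z i (τ j) * u i j)

/-- Rosenbaum dose model for the whole study: independence across matched sets. -/
def prob (γ : ℝ) (u : S.Confounder) (π : S.Assignment) : ℝ :=
  ∏ i, S.setProb γ u i (π i)

/-- Expectation `E_u` under the Rosenbaum dose model. -/
def expect (γ : ℝ) (u : S.Confounder) (g : S.Assignment → ℝ) : ℝ :=
  ∑ π : S.Assignment, S.prob γ u π * g π

/-- Variance `Var_u` under the Rosenbaum dose model. -/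
def variance (γ : ℝ) (u : S.Confounder) (g : S.Assignment → ℝ) : ℝ :=
  S.expect γ u (fun π => (g π - S.expect γ u g) ^ 2)

open Classical in
/-- Probability `P_u` of an event under the Rosenbaum dose model. -/
def probEvent (γ : ℝ) (u : S.Confounder) (A : S.Assignment → Prop) : ℝ :=
  S.expect γ u (fun π => if A π then 1 else 0)

/-- Received dose `Z_{ij}`. -/
def dose (π : S.Assignment) (i : Fin S.I) (j : Fin (S.n i)) : ℝ := S.z i (π i j)

/-- Observed outcome `R_{ij} = r_{ij}(Z_{ij})`. -/
def outcome (π : S.Assignment) (i : Fin S.I) (j : Fin (S.n i)) : ℝ := S.r i j (S.dose π i j)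

/-- `V_{N,i}`: the sum over `j, k` of `f_i^{(k)}(Z_{ij}, R_{ij})` times the indicator that subject
`ij` received the `k`-th ordered dose. -/
def VNSet (i : Fin S.I) (π : S.Assignment) : ℝ :=
  ∑ j, ∑ k, S.f i k (S.dose π i j) (S.outcome π i j) * (if π i j = k then 1 else 0)

/-- `Γ_i^p`: with 1-based ranks, the upper ranks are `⌈n_i/2⌉ + 1, …, n_i` and the lower ranks
are `1, …, ⌊n_i/2⌋`. -/
def GammaP (γ : ℝ) (i : Fin S.I) : ℝ :=
  Real.exp (γ *
    ((∑ k ∈ Finset.univ.filter (fun k : Fin (S.n i) => (S.n i + 1) / 2 ≤ k.val), S.z i k) -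
      ∑ k ∈ Finset.univ.filter (fun k : Fin (S.n i) => k.val < S.n i / 2), S.z i k))

/-- `(Γ_i^p - 1) / (1 + Γ_i^p)`. -/
def kappa (γ : ℝ) (i : Fin S.I) : ℝ := (S.GammaP γ i - 1) / (1 + S.GammaP γ i)

/-- `V_{C,Γ,θ₀,i}`. -/
def VCSet (γ θ₀ : ℝ) (i : Fin S.I) (π : S.Assignment) : ℝ :=
  S.VNSet i π - θ₀ - S.kappa γ i * |S.VNSet i π - θ₀|

/-- `V_{C,Γ,θ₀} = ∑_i (n_i / N) V_{C,Γ,θ₀,i}`. -/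
def VC (γ θ₀ : ℝ) (π : S.Assignment) : ℝ :=
  ∑ i, (S.n i : ℝ) / S.N * S.VCSet γ θ₀ i π

/-- `w_i = I n_i / N`. -/
def weight (i : Fin S.I) : ℝ := (S.I : ℝ) * S.n i / S.N

end DoseStudy

/-- The hat matrix `H_Q = Q (Qᵀ Q)⁻¹ Qᵀ`. -/
def hatMatrix {I L : ℕ} (Q : Matrix (Fin I) (Fin L) ℝ) : Matrix (Fin I) (Fin I) ℝ :=
  Q * (Q.transpose * Q)⁻¹ * Q.transpose

namespace DoseStudy

variable (S : DoseStudy)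

/-- `y_i = V_{C,Γ,θ₀,i} / √(1 - h_{ii})`. -/
def yC (γ θ₀ : ℝ) {L : ℕ} (Q : Matrix (Fin S.I) (Fin L) ℝ) (π : S.Assignment) : Fin S.I → ℝ :=
  fun i => S.VCSet γ θ₀ i π / Real.sqrt (1 - hatMatrix Q i i)

/-- `S²_{C,Γ,θ₀}(Q) = I⁻² y W (1 - H_Q) W yᵀ`, with `W = diag(w_1, …, w_I)`. -/
def varEstC (γ θ₀ : ℝ) {L : ℕ} (Q : Matrix (Fin S.I) (Fin L) ℝ) (π : S.Assignment) : ℝ :=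
  ((S.I : ℝ) ^ 2)⁻¹ *
    dotProduct (S.yC γ θ₀ Q π)
      ((Matrix.diagonal S.weight * (1 - hatMatrix Q) * Matrix.diagonal S.weight).mulVec
        (S.yC γ θ₀ Q π))

/-- The bounding p-value `1 - Φ(V_C / S_C(Q))`. -/
def pValueC (γ θ₀ : ℝ) {L : ℕ} (Q : Matrix (Fin S.I) (Fin L) ℝ) (π : S.Assignment) : ℝ :=
  1 - ProbabilityTheory.cdf (ProbabilityTheory.gaussianReal 0 1)
    (S.VC γ θ₀ π / Real.sqrt (S.varEstC γ θ₀ Q π))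

/-- The additional condition on the true unmeasured confounders `u`, for the estimand value
`θ = S.theta`. -/
def ConfounderCondition (γ θ₀ : ℝ) (u : S.Confounder) : Prop :=
  ∃ u' : S.Confounder, S.Normalized u' ∧
    S.expect γ u (S.VC γ θ₀) ≤ S.expect γ u' (S.VC γ θ₀) ∧
    ∑ i, (S.n i : ℝ) / S.N * S.kappa γ i *
        S.expect γ u' (fun π => |S.VNSet i π - S.thetaSet i|) ≤
      ∑ i, (S.n i : ℝ) / S.N * S.kappa γ i *
        S.expect γ u' (fun π => |S.VNSet i π - S.theta|)

/-- Moment regularity under `P_u`: the weighted contributions `w_i V_{C,Γ,θ₀,i}` have average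
fourth moment at most `C`, and `I` times the variance of `V_{C,Γ,θ₀}` is at least `c`. -/
structure MomentRegular (γ θ₀ c C : ℝ) (u : S.Confounder) : Prop where
  fourth_moment :
    (S.I : ℝ)⁻¹ * ∑ i, S.weight i ^ 4 * S.expect γ u (fun π => S.VCSet γ θ₀ i π ^ 4) ≤ C
  nondegenerate : c ≤ (S.I : ℝ) * S.variance γ u (S.VC γ θ₀)

end DoseStudy

end

open MeasureTheory ProbabilityTheory Filter Topology

/-! The test rejects when `V_C / S` reaches the normal quantile `z` of level `1 - α`. Three facts
bound this probability, with errors depending on the study only through `I`; hence the uniformity in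
`u`.

Sign of the mean (`expect_VC_nonpos`). Within set `i`, two permutations have probability ratio at
most `Γ_i^p`, and under uniform permutations `V_{N,i}` has mean `θ_i`. The absolute-value correction
offsets any such tilt, so the statistic centred at `θ_i` has nonpositive mean under every `u'`.
Replacing `θ_i` by `θ` leaves the weighted linear part unchanged, and the Condition controls the
absolute values.

Conservative variance (`prodProb_varEstC_le`). `I² S²` is the quadratic form of the projection `1 -
H_Q` in the variables `w_i V_{C,i} / √(1 - h_ii)`. The rescaling cancels the diagonal, so its mean
is the variance `V` of `∑ w_i V_{C,i}` plus a nonnegative term from the means. Its fluctuation has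
second moment of order `I^{3/2}`, while `V² ≥ (c I)²`; Chebyshev's inequality gives `I² S² > (1 - η)
V` outside an event of probability of order `I^{-1/2}`.

Central limit theorem (`exists_prodProb_sum_ge_le`). The standardized centred sum has total fourth
moment of order `1 / I`, which controls its characteristic function and so its upper tail.

Since `z ≥ 0`, rejection outside the exceptional event forces the standardized sum above `z √(1 -
η)`; continuity of `Φ` lets `η` be small. -/

/-! ### The standard normal distribution function -/

/-- The standard normal distribution function. -/
noncomputable abbrev stdNormalCdf (x : ℝ) : ℝ := cdf (gaussianReal 0 1) x

lemma gaussianReal_zero_one_singleton (x : ℝ) : gaussianReal 0 1 {x} = 0 :=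
  gaussianReal_absolutelyContinuous 0 one_ne_zero (by simp)

lemma continuous_stdNormalCdf : Continuous stdNormalCdf := by
  rw [continuous_iff_continuousAt]
  intro x
  have hm : Monotone stdNormalCdf := monotone_cdf _
  rw [hm.continuousAt_iff_leftLim_eq_rightLim]
  have h1 := (cdf (gaussianReal 0 1)).measure_singleton x
  rw [measure_cdf, gaussianReal_zero_one_singleton] at h1
  have h2 := ENNReal.ofReal_eq_zero.1 h1.symm
  have h3 : Function.leftLim stdNormalCdf x ≤ stdNormalCdf x := hm.leftLim_le le_rfl
  have h4 : Function.rightLim stdNormalCdf x = stdNormalCdf x :=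
    (cdf (gaussianReal 0 1)).rightLim_eq x
  rw [h4]
  exact le_antisymm h3 (by linarith)

lemma strictMono_stdNormalCdf : StrictMono stdNormalCdf := by
  intro a b hab
  have h1 := (cdf (gaussianReal 0 1)).measure_Ioc a b
  rw [measure_cdf] at h1
  by_contra! h
  rw [ENNReal.ofReal_eq_zero.2 (sub_nonpos.2 h)] at h1
  -- A Gaussian-null interval is Lebesgue-null, hence empty.
  have h2 := gaussianReal_absolutelyContinuous' 0 one_ne_zero h1
  simp at h2
  linarith

lemma gaussianReal_real_Ici (x : ℝ) : (gaussianReal 0 1).real (Set.Ici x) = 1 - stdNormalCdf x := by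
  have h1 : (gaussianReal 0 1).real (Set.Iio x) = (gaussianReal 0 1).real (Set.Iic x) := by
    rw [← Set.Iio_union_right, measureReal_union (by simp) (by simp)]
    simp [measureReal_def, gaussianReal_zero_one_singleton]
  have h2 : Set.Ici x = (Set.Iio x)ᶜ := by simp
  rw [h2, probReal_compl_eq_one_sub measurableSet_Iio, h1, stdNormalCdf, cdf_eq_real]

lemma stdNormalCdf_zero : stdNormalCdf 0 = 1 / 2 := by
  have h1 := gaussianReal_real_Ici 0
  have h2 : (gaussianReal 0 1).real (Set.Ici 0) = (gaussianReal 0 1).real (Set.Iic 0) := by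
    have h := gaussianReal_map_neg (μ := 0) (v := 1)
    rw [neg_zero] at h
    conv_lhs => rw [← h]
    rw [map_measureReal_apply (by fun_prop) measurableSet_Ici]
    congr 1
    ext x
    simp
  rw [h2, ← cdf_eq_real] at h1
  change stdNormalCdf 0 = _ at h1
  linarith

/-- The bound `α ≤ 1 / 2` enters here: the quantile is nonnegative because `Φ(0) = 1 / 2 ≤ 1 - α`.
-/
lemma exists_nonneg_stdNormalCdf_eq {α : ℝ} (hα0 : 0 < α) (hα : α ≤ 1 / 2) :
    ∃ z, 0 ≤ z ∧ stdNormalCdf z = 1 - α := by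
  have h1 : ∀ᶠ x in atTop, 1 - α < stdNormalCdf x :=
    (tendsto_cdf_atTop (gaussianReal 0 1)).eventually (lt_mem_nhds (by linarith))
  obtain ⟨b, hb, hb0⟩ := (h1.and (eventually_ge_atTop 0)).exists
  obtain ⟨z, hz, hz'⟩ := intermediate_value_Icc hb0 continuous_stdNormalCdf.continuousOn
    (show 1 - α ∈ Set.Icc (stdNormalCdf 0) (stdNormalCdf b) from
      ⟨by rw [stdNormalCdf_zero]; linarith, hb.le⟩)
  exact ⟨z, hz.1, hz'⟩

/-- Quantitative form of Lévy's continuity theorem at the standard normal law: closeness of the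
characteristic functions controls upper tails. -/
lemma exists_real_Ici_le_of_charFun_close (z : ℝ) {ε : ℝ} (hε : 0 < ε) :
    ∃ κ : ℝ, 0 < κ ∧ κ ≤ 1 ∧ ∀ ν : Measure ℝ, IsProbabilityMeasure ν →
      (∀ t : ℝ, ‖charFun ν t - Real.exp (-(t ^ 2 / 2))‖ ≤ κ * (4 * |t| ^ 3 + t ^ 4)) →
      ν.real (Set.Ici z) ≤ 1 - stdNormalCdf z + ε := by
  -- No rate is extracted. Failure for every `κ = 1 / (k + 1)` would give laws converging weakly to
  -- the normal law with tails at `z` that stay too large by `ε`, although `{z}` is null for the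
  -- limit.
  by_contra! h
  have hpos : ∀ k : ℕ, (0 : ℝ) < 1 / ((k : ℝ) + 1) := fun k => by positivity
  have hle : ∀ k : ℕ, 1 / ((k : ℝ) + 1) ≤ 1 := fun k => by
    rw [div_le_one (by positivity)]; linarith [(Nat.cast_nonneg k : (0 : ℝ) ≤ k)]
  choose ν hν hclose htail using fun k : ℕ => h (1 / ((k : ℝ) + 1)) (hpos k) (hle k)
  let ν' : ℕ → ProbabilityMeasure ℝ := fun k => ⟨ν k, hν k⟩
  let ν₀ : ProbabilityMeasure ℝ := ⟨gaussianReal 0 1, inferInstance⟩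
  have hlim : Tendsto ν' atTop (𝓝 ν₀) := by
    refine ProbabilityMeasure.tendsto_of_tendsto_charFun fun t => ?_
    have hg : charFun (ν₀ : Measure ℝ) t = (Real.exp (-(t ^ 2 / 2)) : ℝ) := by
      change charFun (gaussianReal 0 1) t = _
      rw [charFun_gaussianReal]
      push_cast
      congr 1
      simp
    rw [hg, tendsto_iff_norm_sub_tendsto_zero]
    have h0 : Tendsto (fun k : ℕ => 1 / ((k : ℝ) + 1) * (4 * |t| ^ 3 + t ^ 4)) atTop (𝓝 0) := by
      have h0 := (tendsto_one_div_add_atTop_nhds_zero_nat (𝕜 := ℝ)).mul_const (4 * |t| ^ 3 + t ^ 4)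
      rwa [zero_mul] at h0
    exact squeeze_zero (fun _ => norm_nonneg _) (fun k => hclose k t) h0
  have h1 := ProbabilityMeasure.tendsto_measure_of_null_frontier_of_tendsto' hlim
    (E := Set.Ici z) (by
      rw [frontier_Ici]
      exact gaussianReal_zero_one_singleton z)
  have h2 := (ENNReal.tendsto_toReal (measure_ne_top _ _)).comp h1
  have h3 : 1 - stdNormalCdf z + ε ≤ (gaussianReal 0 1).real (Set.Ici z) :=
    ge_of_tendsto' h2 fun k => (htail k).le
  rw [gaussianReal_real_Ici] at h3
  linarith

/-! ### Estimates for the exponential function -/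

/-- The crude constant 4 serves all real `x`: for `|x| ≤ 1` the series remainder is smaller, and for
`|x| > 1` the triangle inequality suffices. -/
lemma norm_cexp_mul_I_sub_taylor_le (x : ℝ) :
    ‖Complex.exp (x * Complex.I) - (1 + x * Complex.I - x ^ 2 / 2)‖ ≤ 4 * |x| ^ 3 := by
  rcases le_or_gt |x| 1 with hx | hx
  · have h := Complex.exp_bound (x := x * Complex.I) (by simpa using hx) (n := 3) (by norm_num)
    have e : ∑ m ∈ Finset.range 3, (x * Complex.I) ^ m / (m.factorial : ℂ)
        = 1 + x * Complex.I - x ^ 2 / 2 := by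
      simp [Finset.sum_range_succ, Nat.factorial, mul_pow]
      ring
    rw [e] at h
    refine h.trans ?_
    have : ‖(x : ℂ) * Complex.I‖ = |x| := by simp
    rw [this, mul_comm]
    gcongr
    norm_num [Nat.factorial]
  · have h1 : ‖Complex.exp (x * Complex.I)‖ = 1 := Complex.norm_exp_ofReal_mul_I x
    have h2 : ‖(x : ℂ) * Complex.I‖ = |x| := by simp
    have h3 : ‖(x : ℂ) ^ 2 / 2‖ = |x| ^ 2 / 2 := by simp
    have h4 : ‖Complex.exp (x * Complex.I) - (1 + x * Complex.I - x ^ 2 / 2)‖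
        ≤ 1 + (1 + |x| + |x| ^ 2 / 2) := by
      refine (norm_sub_le _ _).trans (add_le_add h1.le ?_)
      refine (norm_sub_le _ _).trans (add_le_add ?_ h3.le)
      exact (norm_add_le _ _).trans (by simp)
    nlinarith [pow_pos (show 0 < |x| by linarith) 2, pow_pos (show 0 < |x| by linarith) 3,
      mul_pos (sub_pos.2 hx) (pow_pos (show 0 < |x| by linarith) 2)]

lemma abs_exp_neg_sub_one_sub_le {y : ℝ} (hy : 0 ≤ y) : |Real.exp (-y) - (1 - y)| ≤ y ^ 2 := by
  have h0 : 1 - y ≤ Real.exp (-y) := by linarith [Real.add_one_le_exp (-y)]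
  rw [abs_of_nonneg (by linarith)]
  rcases le_or_gt y 1 with h | h
  · have := Real.abs_exp_sub_one_sub_id_le (x := -y) (by rwa [abs_neg, abs_of_nonneg hy])
    have := le_of_abs_le this
    nlinarith
  · have : Real.exp (-y) ≤ 1 := Real.exp_le_one_iff.2 (by linarith)
    nlinarith

/-- Telescoping: factors are exchanged one at a time, the others having norm at most 1. -/
lemma norm_prod_sub_prod_le {ι : Type*} (s : Finset ι) (a b : ι → ℂ)
    (ha : ∀ i ∈ s, ‖a i‖ ≤ 1) (hb : ∀ i ∈ s, ‖b i‖ ≤ 1) :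
    ‖∏ i ∈ s, a i - ∏ i ∈ s, b i‖ ≤ ∑ i ∈ s, ‖a i - b i‖ := by
  classical
  induction s using Finset.induction_on with
  | empty => simp
  | insert i s hi ih =>
    rw [Finset.prod_insert hi, Finset.prod_insert hi, Finset.sum_insert hi]
    have h1 : a i * ∏ j ∈ s, a j - b i * ∏ j ∈ s, b j
        = (a i - b i) * ∏ j ∈ s, a j + b i * (∏ j ∈ s, a j - ∏ j ∈ s, b j) := by ring
    rw [h1]
    refine (norm_add_le _ _).trans (add_le_add ?_ ?_)
    · rw [norm_mul]
      refine mul_le_of_le_one_right (norm_nonneg _) ?_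
      rw [norm_prod]
      exact Finset.prod_le_one (fun _ _ => norm_nonneg _)
        fun j hj => ha j (Finset.mem_insert_of_mem hj)
    · rw [norm_mul]
      refine (mul_le_of_le_one_left (norm_nonneg _) (hb i (Finset.mem_insert_self i s))).trans ?_
      exact ih (fun j hj => ha j (Finset.mem_insert_of_mem hj))
        fun j hj => hb j (Finset.mem_insert_of_mem hj)

/-! ### Expectations on finite product probability spaces -/

/-- The mean of `F` with respect to the weights `q` on a finite type. -/
noncomputable def weightedMean {α : Type*} [Fintype α] (q F : α → ℝ) : ℝ := ∑ x, q x * F x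

/-- A probability mass function on a finite type. -/
structure IsProbWeight {α : Type*} [Fintype α] (q : α → ℝ) : Prop where
  nonneg : ∀ x, 0 ≤ q x
  sum_eq_one : ∑ x, q x = 1

namespace weightedMean

variable {α : Type*} [Fintype α] {q : α → ℝ}

lemma add (F G : α → ℝ) :
    weightedMean q (fun x => F x + G x) = weightedMean q F + weightedMean q G := by
  simp [weightedMean, mul_add, Finset.sum_add_distrib]

lemma sub (F G : α → ℝ) :
    weightedMean q (fun x => F x - G x) = weightedMean q F - weightedMean q G := by
  simp [weightedMean, mul_sub, Finset.sum_sub_distrib]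

lemma const_mul (c : ℝ) (F : α → ℝ) :
    weightedMean q (fun x => c * F x) = c * weightedMean q F := by
  simp only [weightedMean, Finset.mul_sum]
  exact Finset.sum_congr rfl fun _ _ => by ring

lemma const (hq : IsProbWeight q) (c : ℝ) : weightedMean q (fun _ => c) = c := by
  simp [weightedMean, ← Finset.sum_mul, hq.sum_eq_one]

lemma mono (hq : IsProbWeight q) {F G : α → ℝ} (h : ∀ x, F x ≤ G x) :
    weightedMean q F ≤ weightedMean q G :=
  Finset.sum_le_sum fun x _ => mul_le_mul_of_nonneg_left (h x) (hq.nonneg x)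

lemma nonneg (hq : IsProbWeight q) {F : α → ℝ} (h : ∀ x, 0 ≤ F x) : 0 ≤ weightedMean q F :=
  Finset.sum_nonneg fun x _ => mul_nonneg (hq.nonneg x) (h x)

lemma sq_le (hq : IsProbWeight q) (F : α → ℝ) :
    weightedMean q F ^ 2 ≤ weightedMean q (fun x => F x ^ 2) := by
  have h := nonneg hq (F := fun x => (F x - weightedMean q F) ^ 2) fun x => sq_nonneg _
  have e : (fun x => (F x - weightedMean q F) ^ 2)
      = fun x => (F x ^ 2 - (2 * weightedMean q F) * F x) + weightedMean q F ^ 2 := by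
    ext x; ring
  rw [e, add, sub, const_mul, const hq] at h
  linarith

lemma sq_sq_le (hq : IsProbWeight q) (F : α → ℝ) :
    weightedMean q (fun x => F x ^ 2) ^ 2 ≤ weightedMean q (fun x => F x ^ 4) := by
  refine (sq_le hq _).trans_eq ?_
  congr 1; ext x; ring

lemma pow_four_le (hq : IsProbWeight q) (F : α → ℝ) :
    weightedMean q F ^ 4 ≤ weightedMean q (fun x => F x ^ 4) := by
  have h1 := sq_le hq F
  have h2 := sq_sq_le hq F
  have h3 : weightedMean q F ^ 4 = (weightedMean q F ^ 2) ^ 2 := by ring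
  rw [h3]
  exact (pow_le_pow_left₀ (sq_nonneg _) h1 2).trans h2

lemma sub_self_eq_zero (hq : IsProbWeight q) (F : α → ℝ) :
    weightedMean q (fun x => F x - weightedMean q F) = 0 := by
  rw [sub, const hq, sub_self]

/-- The constant is `8 + 8`: `(a - b)^4 ≤ 8 a^4 + 8 b^4`, then Jensen's inequality for the mean. -/
lemma centered_pow_four_le (hq : IsProbWeight q) (F : α → ℝ) :
    weightedMean q (fun x => (F x - weightedMean q F) ^ 4)
      ≤ 16 * weightedMean q (fun x => F x ^ 4) := by
  have h1 : weightedMean q (fun x => (F x - weightedMean q F) ^ 4)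
      ≤ weightedMean q (fun x => 8 * F x ^ 4 + 8 * weightedMean q F ^ 4) := by
    refine mono hq fun x => ?_
    generalize weightedMean q F = m
    nlinarith [sq_nonneg (F x + m), sq_nonneg (F x - m), sq_nonneg (F x ^ 2 - m ^ 2),
      mul_nonneg (sq_nonneg (F x + m)) (sq_nonneg (F x - m)), sq_nonneg ((F x + m) ^ 2),
      mul_nonneg (sq_nonneg (F x + m)) (sq_nonneg (F x + m))]
  rw [add, const_mul, const hq] at h1
  linarith [pow_four_le hq F]

end weightedMean

section Product

variable {ι : Type*} [Fintype ι] [DecidableEq ι] {Ω : ι → Type*} [∀ i, Fintype (Ω i)]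

/-- Expectation with respect to the product of the weights `p i`. -/
noncomputable def prodExpect (p : ∀ i, Ω i → ℝ) (g : (∀ i, Ω i) → ℝ) : ℝ :=
  ∑ ω, (∏ i, p i (ω i)) * g ω

open Classical in
/-- Probability with respect to the product of the weights `p i`. -/
noncomputable def prodProb (p : ∀ i, Ω i → ℝ) (A : (∀ i, Ω i) → Prop) : ℝ :=
  prodExpect p (fun ω => if A ω then 1 else 0)

variable {p : ∀ i, Ω i → ℝ}

lemma prodExpect_add (f g : (∀ i, Ω i) → ℝ) :
    prodExpect p (fun ω => f ω + g ω) = prodExpect p f + prodExpect p g := by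
  simp [prodExpect, mul_add, Finset.sum_add_distrib]

lemma prodExpect_const_mul (c : ℝ) (g : (∀ i, Ω i) → ℝ) :
    prodExpect p (fun ω => c * g ω) = c * prodExpect p g := by
  simp only [prodExpect, Finset.mul_sum]
  exact Finset.sum_congr rfl fun _ _ => by ring

lemma prodExpect_sum {β : Type*} (s : Finset β) (g : β → (∀ i, Ω i) → ℝ) :
    prodExpect p (fun ω => ∑ b ∈ s, g b ω) = ∑ b ∈ s, prodExpect p (g b) := by
  simp only [prodExpect, Finset.mul_sum]
  exact Finset.sum_comm

/-- Independence as factorization; the moment formulas below take most factors equal to 1. -/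
lemma prodExpect_prod (F : ∀ i, Ω i → ℝ) :
    prodExpect p (fun ω => ∏ i, F i (ω i)) = ∏ i, weightedMean (p i) (F i) := by
  simp only [weightedMean, Finset.prod_univ_sum, Fintype.piFinset_univ, prodExpect,
    Finset.prod_mul_distrib]

lemma prodExpect_mono (hp : ∀ i, IsProbWeight (p i)) {f g : (∀ i, Ω i) → ℝ}
    (h : ∀ ω, f ω ≤ g ω) : prodExpect p f ≤ prodExpect p g :=
  Finset.sum_le_sum fun ω _ =>
    mul_le_mul_of_nonneg_left (h ω) (Finset.prod_nonneg fun i _ => (hp i).nonneg _)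

lemma sum_prod_eq_one (hp : ∀ i, IsProbWeight (p i)) : ∑ ω : ∀ i, Ω i, ∏ i, p i (ω i) = 1 := by
  have h := Finset.prod_univ_sum (fun i => (Finset.univ : Finset (Ω i))) p
  rw [Fintype.piFinset_univ] at h
  rw [← h]
  exact Finset.prod_eq_one fun i _ => (hp i).sum_eq_one

/-- Moments of products of coordinate functions at two different coordinates. -/
lemma prodExpect_mul_of_ne (hp : ∀ i, IsProbWeight (p i)) (f g : ∀ i, Ω i → ℝ) {i j : ι}
    (hij : i ≠ j) :
    prodExpect p (fun ω => f i (ω i) * g j (ω j))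
      = weightedMean (p i) (f i) * weightedMean (p j) (g j) := by
  have h := prodExpect_prod (p := p)
    fun l x => (if l = i then f l x else 1) * (if l = j then g l x else 1)
  have e : (fun ω : ∀ i, Ω i => f i (ω i) * g j (ω j)) = fun ω => ∏ l,
      ((if l = i then f l (ω l) else 1) * (if l = j then g l (ω l) else 1)) := by
    ext ω
    rw [Finset.prod_mul_distrib]
    simp
  rw [e, h]
  have e2 : ∀ l, weightedMean (p l)
      (fun x => (if l = i then f l x else 1) * (if l = j then g l x else 1))
      = (if l = i then weightedMean (p l) (f l) else 1) *
        (if l = j then weightedMean (p l) (g l) else 1) := by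
    intro l
    by_cases hi : l = i
    · subst hi; simp [hij]
    · by_cases hj : l = j
      · subst hj; simp [hi]
      · simp [hi, hj, weightedMean.const (hp l)]
  simp_rw [e2, Finset.prod_mul_distrib]
  simp

lemma prodExpect_eval (hp : ∀ i, IsProbWeight (p i)) (i : ι) (F : Ω i → ℝ) :
    prodExpect p (fun ω => F (ω i)) = weightedMean (p i) F := by
  have h := prodExpect_prod (p := p) (Function.update (fun _ _ => 1) i F)
  have e : (fun ω : ∀ i, Ω i => F (ω i))
      = fun ω => ∏ l, (Function.update (fun _ _ => (1 : ℝ)) i F : ∀ i, Ω i → ℝ) l (ω l) := by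
    ext ω
    rw [Finset.prod_eq_single i (fun l _ hl => by simp [hl]) (by simp)]
    simp
  rw [e, h, Finset.prod_eq_single i (fun l _ hl => by simp [hl, weightedMean.const (hp l)])
    (by simp)]
  simp

/-- A centred factor at a coordinate on which nothing else depends makes the moment vanish. -/
lemma prodExpect_mul_prod_eq_zero (e : ∀ i, Ω i → ℝ) {i : ι}
    (he : weightedMean (p i) (e i) = 0) (G : ∀ l, Ω l → ℝ) (hG : ∀ x, G i x = 1) :
    prodExpect p (fun ω => e i (ω i) * ∏ l, G l (ω l)) = 0 := by
  have h := prodExpect_prod (p := p) fun l x => (if l = i then e l x else 1) * G l x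
  have e1 : (fun ω : ∀ i, Ω i => e i (ω i) * ∏ l, G l (ω l)) = fun ω => ∏ l,
      ((if l = i then e l (ω l) else 1) * G l (ω l)) := by
    ext ω
    rw [Finset.prod_mul_distrib]
    simp
  rw [e1, h]
  exact Finset.prod_eq_zero (Finset.mem_univ i) (by simpa [hG] using he)

lemma prodProb_le_prodExpect (hp : ∀ i, IsProbWeight (p i)) {A : (∀ i, Ω i) → Prop}
    {g : (∀ i, Ω i) → ℝ} (hg : ∀ ω, 0 ≤ g ω) (h : ∀ ω, A ω → 1 ≤ g ω) :
    prodProb p A ≤ prodExpect p g := by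
  refine prodExpect_mono hp fun ω => ?_
  split_ifs with hA
  · exact h ω hA
  · exact hg ω

lemma prodProb_le_add (hp : ∀ i, IsProbWeight (p i)) {A B D : (∀ i, Ω i) → Prop}
    (h : ∀ ω, A ω → B ω ∨ D ω) : prodProb p A ≤ prodProb p B + prodProb p D := by
  classical
  rw [prodProb, prodProb, prodProb, ← prodExpect_add]
  refine prodExpect_mono hp fun ω => ?_
  by_cases hA : A ω
  · rcases h ω hA with hB | hD
    · simp only [hA, hB, if_true]; split_ifs <;> norm_num
    · simp only [hA, hD, if_true]; split_ifs <;> norm_num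
  · simp only [hA, if_false]; split_ifs <;> norm_num

lemma prodExpect_sum_sq (hp : ∀ i, IsProbWeight (p i)) (e : ∀ i, Ω i → ℝ)
    (he : ∀ i, weightedMean (p i) (e i) = 0) :
    prodExpect p (fun ω => (∑ i, e i (ω i)) ^ 2)
      = ∑ i, weightedMean (p i) (fun x => e i x ^ 2) := by
  simp_rw [sq, Finset.sum_mul_sum, prodExpect_sum]
  refine Finset.sum_congr rfl fun i _ => ?_
  rw [Finset.sum_eq_single i]
  · exact prodExpect_eval hp i fun x => e i x * e i x
  · intro j _ hj
    rw [prodExpect_mul_of_ne hp e e hj.symm, he i, zero_mul]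
  · simp

/-- Unless `{i, j} = {k, l}`, some index occurs exactly once, and its centred factor annihilates the
moment. -/
lemma prodExpect_four (hp : ∀ i, IsProbWeight (p i)) (e : ∀ i, Ω i → ℝ)
    (he : ∀ i, weightedMean (p i) (e i) = 0) {i j k l : ι} (hij : i ≠ j) (hkl : k ≠ l) :
    prodExpect p (fun ω => e i (ω i) * e j (ω j) * (e k (ω k) * e l (ω l)))
      = ((if k = i then if l = j then 1 else 0 else 0)
          + (if k = j then if l = i then 1 else 0 else 0)) *
        (weightedMean (p i) (fun x => e i x ^ 2) * weightedMean (p j) (fun x => e j x ^ 2)) := by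
  have key := prodExpect_mul_of_ne hp (fun m x => e m x ^ 2) (fun m x => e m x ^ 2) hij
  by_cases h1 : k = i ∧ l = j
  · obtain ⟨rfl, rfl⟩ := h1
    simp only [if_true, hij, if_false, add_zero, one_mul]
    rw [← key]
    congr 1; ext ω; ring
  by_cases h2 : k = j ∧ l = i
  · obtain ⟨rfl, rfl⟩ := h2
    simp only [if_true, hkl, if_false, zero_add, one_mul]
    rw [← key]
    congr 1; ext ω; ring
  have h3 : ((if k = i then if l = j then 1 else 0 else 0)
          + (if k = j then if l = i then 1 else 0 else 0) : ℝ) = 0 := by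
    split_ifs <;> simp_all
  rw [h3, zero_mul]
  have single : ∀ a b c d : ι, a ≠ b → a ≠ c → a ≠ d →
      prodExpect p (fun ω => e a (ω a) * (e b (ω b) * e c (ω c) * e d (ω d))) = 0 := by
    intro a b c d hab hac had
    have := prodExpect_mul_prod_eq_zero e (he a) (fun m x => (if m = b then e m x else 1) *
      (if m = c then e m x else 1) * (if m = d then e m x else 1)) (by simp [hab, hac, had])
    simp only [Finset.prod_mul_distrib] at this
    simpa using this
  -- If `i` is repeated then `j` is the isolated index, since the pairs differ; otherwise `i` is.
  by_cases hi : i = k ∨ i = l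
  · have := single j i k l hij.symm (by grind) (by grind)
    rw [← this]
    congr 1; ext ω; ring
  · push Not at hi
    have := single i j k l hij hi.1 hi.2
    rw [← this]
    congr 1; ext ω; ring

/-- Only the pairings `(k, l) = (i, j)` and `(k, l) = (j, i)` survive; by symmetry of `B` they
agree, whence the factor 2. -/
lemma prodExpect_offdiag_sq (hp : ∀ i, IsProbWeight (p i)) (e : ∀ i, Ω i → ℝ)
    (he : ∀ i, weightedMean (p i) (e i) = 0) (B : ι → ι → ℝ) (hB : ∀ i j, B i j = B j i)
    (hB0 : ∀ i, B i i = 0) :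
    prodExpect p (fun ω => (∑ i, ∑ j, B i j * (e i (ω i) * e j (ω j))) ^ 2)
      = 2 * ∑ i, ∑ j, B i j ^ 2 *
        (weightedMean (p i) (fun x => e i x ^ 2) * weightedMean (p j) (fun x => e j x ^ 2)) := by
  have h1 : (fun ω : ∀ i, Ω i => (∑ i, ∑ j, B i j * (e i (ω i) * e j (ω j))) ^ 2)
      = fun ω => ∑ i, ∑ j, ∑ k, ∑ l, B i j * B k l *
        (e i (ω i) * e j (ω j) * (e k (ω k) * e l (ω l))) := by
    ext ω
    simp_rw [sq, Finset.sum_mul, Finset.mul_sum]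
    refine Finset.sum_congr rfl fun i _ => Finset.sum_congr rfl fun j _ =>
      Finset.sum_congr rfl fun k _ => Finset.sum_congr rfl fun l _ => by ring
  rw [h1]
  simp_rw [prodExpect_sum, prodExpect_const_mul, Finset.mul_sum]
  refine Finset.sum_congr rfl fun i _ => Finset.sum_congr rfl fun j _ => ?_
  by_cases hij : i = j
  · subst hij; simp [hB0]
  have h2 : ∀ k l, B i j * B k l *
      prodExpect p (fun ω => e i (ω i) * e j (ω j) * (e k (ω k) * e l (ω l)))
      = (if k = i then if l = j then B i j * B k l *
          (weightedMean (p i) (fun x => e i x ^ 2) * weightedMean (p j) (fun x => e j x ^ 2))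
          else 0 else 0)
        + (if k = j then if l = i then B i j * B k l *
          (weightedMean (p i) (fun x => e i x ^ 2) * weightedMean (p j) (fun x => e j x ^ 2))
          else 0 else 0) := by
    intro k l
    by_cases hkl : k = l
    · subst hkl; simp [hB0]
    rw [prodExpect_four hp e he hij hkl]
    split_ifs <;> ring
  simp_rw [h2, Finset.sum_add_distrib]
  simp [hB j i]
  ring

end Product

section Product

variable {ι : Type*} [Fintype ι] [DecidableEq ι] {Ω : ι → Type*} [∀ i, Fintype (Ω i)]
variable {p : ∀ i, Ω i → ℝ}

/-! ### A central limit theorem for sums of independent variables with finitely many values -/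

/-- The law of a random variable on a finite product probability space. -/
noncomputable def prodLaw (p : ∀ i, Ω i → ℝ) (g : (∀ i, Ω i) → ℝ) : Measure ℝ :=
  ∑ ω, ENNReal.ofReal (∏ i, p i (ω i)) • Measure.dirac (g ω)

lemma isProbabilityMeasure_prodLaw (hp : ∀ i, IsProbWeight (p i)) (g : (∀ i, Ω i) → ℝ) :
    IsProbabilityMeasure (prodLaw p g) := by
  constructor
  simp only [prodLaw, Measure.coe_finsetSum, Finset.sum_apply, Measure.smul_apply, measure_univ,
    smul_eq_mul, mul_one]
  rw [← ENNReal.ofReal_sum_of_nonneg fun ω _ => Finset.prod_nonneg fun i _ => (hp i).nonneg _,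
    sum_prod_eq_one hp, ENNReal.ofReal_one]

lemma prodLaw_real_Ici (hp : ∀ i, IsProbWeight (p i)) (g : (∀ i, Ω i) → ℝ) (z : ℝ) :
    (prodLaw p g).real (Set.Ici z) = prodProb p (fun ω => z ≤ g ω) := by
  simp only [measureReal_def, prodLaw, Measure.coe_finsetSum, Finset.sum_apply,
    Measure.smul_apply, smul_eq_mul, Measure.dirac_apply' _ measurableSet_Ici]
  rw [ENNReal.toReal_sum fun ω _ => by
    by_cases h : g ω ∈ Set.Ici z <;> simp [h]]
  refine Finset.sum_congr rfl fun ω _ => ?_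
  rw [ENNReal.toReal_mul, ENNReal.toReal_ofReal (Finset.prod_nonneg fun i _ => (hp i).nonneg _)]
  by_cases h : z ≤ g ω <;> simp [h]

lemma charFun_prodLaw_sum (hp : ∀ i, IsProbWeight (p i)) (X : ∀ i, Ω i → ℝ) (t : ℝ) :
    charFun (prodLaw p fun ω => ∑ i, X i (ω i)) t
      = ∏ i, ∑ x, (p i x : ℂ) * Complex.exp ((t * X i x : ℝ) * Complex.I) := by
  rw [charFun_apply_real, prodLaw, integral_finsetSum_measure]
  · rw [Finset.prod_univ_sum, Fintype.piFinset_univ]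
    refine Finset.sum_congr rfl fun ω _ => ?_
    rw [integral_smul_measure, integral_dirac,
      ENNReal.toReal_ofReal (Finset.prod_nonneg fun i _ => (hp i).nonneg _),
      Finset.prod_mul_distrib, ← Complex.exp_sum, Complex.real_smul]
    push_cast
    rw [Finset.mul_sum, Finset.sum_mul]
  · intro ω _
    exact Integrable.smul_measure (integrable_dirac (by simp)) ENNReal.ofReal_ne_top

/-- A centred variable and the normal law of the same variance agree to second order. The cubic
remainder is split by `2 |X|^3 ≤ κ X^2 + κ⁻¹ X^4`, so third moments never appear and `κ` remains
free to balance the two terms. -/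
lemma norm_weighted_charFun_sub_le {α : Type*} [Fintype α] {q : α → ℝ} (hq : IsProbWeight q)
    (X : α → ℝ) (hX : weightedMean q X = 0) (t : ℝ) {κ : ℝ} (hκ : 0 < κ) :
    ‖∑ x, (q x : ℂ) * Complex.exp ((t * X x : ℝ) * Complex.I)
        - Real.exp (-(t ^ 2 * weightedMean q (fun x => X x ^ 2) / 2))‖
      ≤ 2 * |t| ^ 3 * (κ * weightedMean q (fun x => X x ^ 2)
          + κ⁻¹ * weightedMean q (fun x => X x ^ 4))
        + t ^ 4 * weightedMean q (fun x => X x ^ 4) := by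
  set v := weightedMean q (fun x => X x ^ 2) with hv
  set b := weightedMean q (fun x => X x ^ 4) with hb
  have hv0 : 0 ≤ v := weightedMean.nonneg hq fun x => sq_nonneg _
  have hvb : v ^ 2 ≤ b := weightedMean.sq_sq_le hq X
  have e1 : ∑ x, (q x : ℂ) * (1 + (t * X x : ℝ) * Complex.I - ((t * X x : ℝ) : ℂ) ^ 2 / 2)
      = ((1 - t ^ 2 * v / 2 : ℝ) : ℂ) := by
    have h1 : ∑ x, (q x : ℂ) = 1 := by exact_mod_cast hq.sum_eq_one
    have h2 : ∑ x, (q x : ℂ) * X x = 0 := by exact_mod_cast hX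
    have h3 : ∑ x, (q x : ℂ) * (X x : ℂ) ^ 2 = v := by rw [hv, weightedMean]; push_cast; rfl
    have h4 : ∑ x, (q x : ℂ) * (1 + (t * X x : ℝ) * Complex.I - ((t * X x : ℝ) : ℂ) ^ 2 / 2)
        = ∑ x, (q x : ℂ) + t * Complex.I * ∑ x, (q x : ℂ) * X x
          - t ^ 2 / 2 * ∑ x, (q x : ℂ) * (X x : ℂ) ^ 2 := by
      rw [Finset.mul_sum, Finset.mul_sum, ← Finset.sum_add_distrib, ← Finset.sum_sub_distrib]
      refine Finset.sum_congr rfl fun x _ => ?_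
      push_cast
      ring
    rw [h4, h1, h2, h3]
    push_cast
    ring
  have e2 : ∑ x, (q x : ℂ) * Complex.exp ((t * X x : ℝ) * Complex.I)
        - Real.exp (-(t ^ 2 * v / 2))
      = ∑ x, (q x : ℂ) * (Complex.exp ((t * X x : ℝ) * Complex.I)
          - (1 + (t * X x : ℝ) * Complex.I - ((t * X x : ℝ) : ℂ) ^ 2 / 2))
        - ((Real.exp (-(t ^ 2 * v / 2)) - (1 - t ^ 2 * v / 2) : ℝ) : ℂ) := by
    simp_rw [mul_sub (_ : ℂ) (Complex.exp _)]
    rw [Finset.sum_sub_distrib, e1]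
    push_cast
    ring
  rw [e2]
  refine (norm_sub_le _ _).trans (add_le_add ?_ ?_)
  · have h1 : ∀ x, ‖(q x : ℂ) * (Complex.exp ((t * X x : ℝ) * Complex.I)
          - (1 + (t * X x : ℝ) * Complex.I - ((t * X x : ℝ) : ℂ) ^ 2 / 2))‖
        ≤ 2 * |t| ^ 3 * (κ * (q x * X x ^ 2) + κ⁻¹ * (q x * X x ^ 4)) := by
      intro x
      have hq0 := hq.nonneg x
      rw [norm_mul, Complex.norm_real, Real.norm_of_nonneg hq0]
      have h2 := norm_cexp_mul_I_sub_taylor_le (t * X x)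
      have h3 : 2 * |X x| ^ 3 ≤ κ * X x ^ 2 + κ⁻¹ * X x ^ 4 := by
        have h4 : κ * X x ^ 2 + κ⁻¹ * X x ^ 4 - 2 * |X x| ^ 3
            = κ⁻¹ * (|X x| ^ 2 * (κ - |X x|) ^ 2) := by
          rw [← sq_abs (X x), show X x ^ 4 = |X x| ^ 4 from (Even.pow_abs (by decide) _).symm]
          field_simp
          ring
        have : 0 ≤ κ⁻¹ * (|X x| ^ 2 * (κ - |X x|) ^ 2) := by positivity
        linarith
      have h5 : 4 * |t * X x| ^ 3 = 2 * |t| ^ 3 * (2 * |X x| ^ 3) := by rw [abs_mul]; ring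
      calc q x * _ ≤ q x * (2 * |t| ^ 3 * (κ * X x ^ 2 + κ⁻¹ * X x ^ 4)) := by
            refine mul_le_mul_of_nonneg_left (h2.trans ?_) hq0
            rw [h5]
            gcongr
        _ = _ := by ring
    refine (norm_sum_le _ _).trans ((Finset.sum_le_sum fun x _ => h1 x).trans_eq ?_)
    rw [← Finset.mul_sum, Finset.sum_add_distrib, ← Finset.mul_sum, ← Finset.mul_sum]
    rfl
  · rw [Complex.norm_real, Real.norm_eq_abs]
    refine (abs_exp_neg_sub_one_sub_le (by positivity)).trans ?_
    nlinarith [sq_nonneg (t ^ 2), mul_nonneg (sq_nonneg (t ^ 2)) (sub_nonneg.2 hvb),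
      mul_nonneg (sq_nonneg (t ^ 2)) (sq_nonneg v)]

/-- Upper tails of standardized sums of independent variables, uniformly over all arrays whose
total fourth moment is small. -/
theorem exists_prodProb_sum_ge_le (z : ℝ) {ε : ℝ} (hε : 0 < ε) :
    ∃ κ : ℝ, 0 < κ ∧ ∀ {ι : Type} [Fintype ι] [DecidableEq ι] {Ω : ι → Type}
      [∀ i, Fintype (Ω i)] (p : ∀ i, Ω i → ℝ) (X : ∀ i, Ω i → ℝ),
      (∀ i, IsProbWeight (p i)) → (∀ i, weightedMean (p i) (X i) = 0) →
      ∑ i, weightedMean (p i) (fun x => X i x ^ 2) = 1 →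
      ∑ i, weightedMean (p i) (fun x => X i x ^ 4) ≤ κ →
      prodProb p (fun ω => z ≤ ∑ i, X i (ω i)) ≤ 1 - stdNormalCdf z + ε := by
  obtain ⟨κ, hκ, hκ1, H⟩ := exists_real_Ici_le_of_charFun_close z hε
  -- A fourth-moment budget of `κ ^ 2` keeps `κ⁻¹` times the fourth moments below `κ`; with `κ ≤ 1`
  -- the moments themselves are also below `κ`.
  refine ⟨κ ^ 2, by positivity, ?_⟩
  intro ι _ _ Ω _ p X hp hX hv hb
  rw [← prodLaw_real_Ici hp]
  refine H _ (isProbabilityMeasure_prodLaw hp _) fun t => ?_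
  have e : ((Real.exp (-(t ^ 2 / 2)) : ℝ) : ℂ)
      = ∏ i, ((Real.exp (-(t ^ 2 * weightedMean (p i) (fun x => X i x ^ 2) / 2)) : ℝ) : ℂ) := by
    rw [← Complex.ofReal_prod, ← Real.exp_sum]
    congr 2
    rw [Finset.sum_neg_distrib, ← Finset.sum_div, ← Finset.mul_sum, hv, mul_one]
  rw [charFun_prodLaw_sum hp, e]
  refine (norm_prod_sub_prod_le _ _ _ ?_ ?_).trans ?_
  · intro i _
    refine (norm_sum_le _ _).trans ?_
    rw [← (hp i).sum_eq_one]
    refine Finset.sum_le_sum fun x _ => ?_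
    rw [norm_mul, Complex.norm_exp_ofReal_mul_I, mul_one, Complex.norm_real,
      Real.norm_of_nonneg ((hp i).nonneg x)]
  · intro i _
    rw [Complex.norm_real, Real.norm_of_nonneg (Real.exp_pos _).le, Real.exp_le_one_iff]
    have := weightedMean.nonneg (hp i) (F := fun x => X i x ^ 2) fun x => sq_nonneg _
    have : 0 ≤ t ^ 2 * weightedMean (p i) (fun x => X i x ^ 2) / 2 := by positivity
    linarith
  · refine (Finset.sum_le_sum fun i _ =>
      norm_weighted_charFun_sub_le (hp i) (X i) (hX i) t hκ).trans ?_
    rw [Finset.sum_add_distrib, ← Finset.mul_sum, ← Finset.mul_sum, Finset.sum_add_distrib,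
      ← Finset.mul_sum, ← Finset.mul_sum, hv]
    have h1 : κ⁻¹ * ∑ i, weightedMean (p i) (fun x => X i x ^ 4) ≤ κ := by
      rw [inv_mul_le_iff₀ hκ]
      nlinarith
    have h2 : ∑ i, weightedMean (p i) (fun x => X i x ^ 4) ≤ κ := by nlinarith
    calc _ ≤ 2 * |t| ^ 3 * (κ * 1 + κ) + t ^ 4 * κ := by gcongr
      _ = _ := by ring

/-! ### Quadratic forms in independent variables -/

/-- Lower tail of a projection quadratic form `∑ A i j * Z i * Z j`, relative to the contribution
of the variances to its mean. -/
theorem prodProb_quadForm_le (hp : ∀ i, IsProbWeight (p i)) [Nonempty ι] (A : Matrix ι ι ℝ)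
    (hsymm : A.transpose = A) (hidem : A * A = A) (Z : ∀ i, Ω i → ℝ) {B : ℝ}
    (hB : ∑ i, weightedMean (p i) (fun x => Z i x ^ 4) ≤ B) {η : ℝ} (hη : 0 < η) :
    prodProb p (fun ω => (∑ i, ∑ j, A i j * (Z i (ω i) * Z j (ω j))) + η ≤
        ∑ i, A i i * weightedMean (p i) (fun x => (Z i x - weightedMean (p i) (Z i)) ^ 2))
      ≤ 192 * B * Real.sqrt (Fintype.card ι) / η ^ 2 := by
  set m : ι → ℝ := fun i => weightedMean (p i) (Z i) with hm
  set e : ∀ i, Ω i → ℝ := fun i x => Z i x - m i with he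
  set v : ι → ℝ := fun i => weightedMean (p i) (fun x => e i x ^ 2) with hv
  set b : ι → ℝ := fun i => weightedMean (p i) (fun x => e i x ^ 4) with hb
  have he0 : ∀ i, weightedMean (p i) (e i) = 0 := fun i =>
    weightedMean.sub_self_eq_zero (hp i) (Z i)
  have hv0 : ∀ i, 0 ≤ v i := fun i => weightedMean.nonneg (hp i) fun x => sq_nonneg _
  have hb0 : ∀ i, 0 ≤ b i := fun i => weightedMean.nonneg (hp i) fun x => by positivity
  have hvb : ∀ i, v i ^ 2 ≤ b i := fun i => weightedMean.sq_sq_le (hp i) _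
  have hA : ∀ i j, A i j = A j i := fun i j => by
    conv_lhs => rw [← hsymm]
    rfl
  have hAA : ∀ i k, ∑ j, A i j * A j k = A i k := fun i k => by
    conv_rhs => rw [← hidem]
    rw [Matrix.mul_apply]
  -- Symmetry and idempotence make the squared row norm the diagonal entry, which therefore lies in
  -- `[0, 1]`.
  have hrow : ∀ i, ∑ j, A i j ^ 2 = A i i := fun i => by
    rw [← hAA i i]
    exact Finset.sum_congr rfl fun j _ => by rw [hA j i, sq]
  have hAii0 : ∀ i, 0 ≤ A i i := fun i => by
    rw [← hrow]; exact Finset.sum_nonneg fun j _ => sq_nonneg _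
  have hAii1 : ∀ i, A i i ≤ 1 := fun i => by
    have h1 : A i i ^ 2 ≤ ∑ j, A i j ^ 2 :=
      Finset.single_le_sum (f := fun j => A i j ^ 2) (fun j _ => sq_nonneg _) (Finset.mem_univ i)
    rw [hrow] at h1
    nlinarith [hAii0 i]
  set B4 : ℝ := ∑ i, b i with hB4
  have hB4nn : 0 ≤ B4 := Finset.sum_nonneg fun i _ => hb0 i
  have hB4le : B4 ≤ 16 * B := by
    refine le_trans ?_ (mul_le_mul_of_nonneg_left hB (by norm_num))
    rw [Finset.mul_sum]
    exact Finset.sum_le_sum fun i _ => weightedMean.centered_pow_four_le (hp i) (Z i)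
  have hBnn : 0 ≤ B := by linarith
  set r : ℝ := Real.sqrt (Fintype.card ι) with hr
  have hr1 : 1 ≤ r := by
    rw [hr, Real.one_le_sqrt]
    exact_mod_cast Fintype.card_pos
  set g : ι → ℝ := fun i => ∑ j, A i j * m j with hg
  -- With `g = A m`, `‖A m‖² = ⟨m, A m⟩`: the means contribute nonnegatively to the form, and `‖A m‖
  -- ≤ ‖m‖` will bound the linear fluctuation.
  have hgm : ∑ i, g i ^ 2 = ∑ i, m i * g i := by
    calc ∑ i, g i ^ 2 = ∑ i, ∑ j, ∑ k, (A j i * A i k) * (m j * m k) := by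
          refine Finset.sum_congr rfl fun i _ => ?_
          rw [sq, hg, Finset.sum_mul_sum]
          refine Finset.sum_congr rfl fun j _ => Finset.sum_congr rfl fun k _ => ?_
          rw [hA j i]; ring
      _ = ∑ j, ∑ k, ∑ i, (A j i * A i k) * (m j * m k) := by
          rw [Finset.sum_comm]
          exact Finset.sum_congr rfl fun j _ => Finset.sum_comm
      _ = ∑ i, m i * g i := by
          refine Finset.sum_congr rfl fun j _ => ?_
          rw [hg, Finset.mul_sum]
          refine Finset.sum_congr rfl fun k _ => ?_
          rw [← Finset.sum_mul, hAA]; ring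
  have hg0 : 0 ≤ ∑ i, m i * g i := hgm ▸ Finset.sum_nonneg fun i _ => sq_nonneg _
  have hg2 : ∑ i, g i ^ 2 ≤ ∑ i, m i ^ 2 := by
    have h1 : ∑ i, (m i - g i) ^ 2 = ∑ i, m i ^ 2 - 2 * (∑ i, m i * g i) + ∑ i, g i ^ 2 := by
      rw [Finset.mul_sum, ← Finset.sum_sub_distrib, ← Finset.sum_add_distrib]
      exact Finset.sum_congr rfl fun i _ => by ring
    have h2 : 0 ≤ ∑ i, (m i - g i) ^ 2 := Finset.sum_nonneg fun i _ => sq_nonneg _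
    linarith
  -- Cauchy–Schwarz against fourth moments; this is the source of the factor `√card`.
  have hm2 : ∑ i, m i ^ 2 ≤ Real.sqrt B * r := by
    rw [hr, ← Real.sqrt_mul hBnn]
    refine Real.le_sqrt_of_sq_le ?_
    have h1 := sq_sum_le_card_mul_sum_sq (s := Finset.univ) (f := fun i => m i ^ 2)
    refine h1.trans ?_
    rw [mul_comm, Finset.card_univ]
    refine mul_le_mul_of_nonneg_right ?_ (by positivity)
    refine (Finset.sum_le_sum fun i _ => ?_).trans hB
    rw [← pow_mul]
    exact weightedMean.pow_four_le (hp i) (Z i)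
  have hvmax : ∀ i, v i ≤ 4 * Real.sqrt B := fun i => by
    have h1 : v i ^ 2 ≤ 16 * B := (hvb i).trans
      ((Finset.single_le_sum (fun j _ => hb0 j) (Finset.mem_univ i)).trans hB4le)
    refine abs_le_of_sq_le_sq' ?_ (by positivity) |>.2
    rw [mul_pow, Real.sq_sqrt hBnn]
    linarith
  -- the fluctuation of the quadratic form
  set D1 : (∀ i, Ω i) → ℝ := fun ω => ∑ i, g i * e i (ω i) with hD1
  set D2 : (∀ i, Ω i) → ℝ := fun ω => ∑ i, A i i * (e i (ω i) ^ 2 - v i) with hD2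
  set D3 : (∀ i, Ω i) → ℝ := fun ω =>
    ∑ i, ∑ j, (if i = j then 0 else A i j) * (e i (ω i) * e j (ω j)) with hD3
  have hE1 : prodExpect p (fun ω => D1 ω ^ 2) ≤ 4 * B * r := by
    have h1 := prodExpect_sum_sq hp (fun i x => g i * e i x) fun i => by
      rw [weightedMean.const_mul, he0, mul_zero]
    rw [hD1, h1]
    have h2 : ∀ i, weightedMean (p i) (fun x => (g i * e i x) ^ 2) = g i ^ 2 * v i := fun i => by
      rw [hv, ← weightedMean.const_mul]
      congr 1; ext x; ring
    simp_rw [h2]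
    calc ∑ i, g i ^ 2 * v i ≤ ∑ i, g i ^ 2 * (4 * Real.sqrt B) :=
          Finset.sum_le_sum fun i _ => mul_le_mul_of_nonneg_left (hvmax i) (sq_nonneg _)
      _ = (∑ i, g i ^ 2) * (4 * Real.sqrt B) := by rw [Finset.sum_mul]
      _ ≤ (Real.sqrt B * r) * (4 * Real.sqrt B) := by
          gcongr
          exact hg2.trans hm2
      _ = 4 * (Real.sqrt B * Real.sqrt B) * r := by ring
      _ = 4 * B * r := by rw [Real.mul_self_sqrt hBnn]
  have hE2 : prodExpect p (fun ω => D2 ω ^ 2) ≤ 16 * B := by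
    have h1 := prodExpect_sum_sq hp (fun i x => A i i * (e i x ^ 2 - v i)) fun i => by
      rw [weightedMean.const_mul]
      exact mul_eq_zero_of_right _ (weightedMean.sub_self_eq_zero (hp i) _)
    rw [hD2, h1]
    refine (Finset.sum_le_sum fun i _ => ?_).trans hB4le
    calc weightedMean (p i) (fun x => (A i i * (e i x ^ 2 - v i)) ^ 2)
        ≤ weightedMean (p i) (fun x => (e i x ^ 4 - 2 * v i * e i x ^ 2) + v i ^ 2) := by
          refine weightedMean.mono (hp i) fun x => ?_
          have h3 : A i i ^ 2 ≤ 1 := pow_le_one₀ (hAii0 i) (hAii1 i)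
          have h4 := mul_le_mul_of_nonneg_right h3 (sq_nonneg (e i x ^ 2 - v i))
          rw [mul_pow]
          linarith
      _ = b i - 2 * v i * v i + v i ^ 2 := by
          rw [weightedMean.add, weightedMean.sub, weightedMean.const_mul, weightedMean.const (hp i)]
      _ ≤ b i := by nlinarith [sq_nonneg (v i)]
  -- `v i * v j` is replaced by the average of the squares and the row sums collapse to the
  -- diagonal, so no factor `card` is lost.
  have hE3 : prodExpect p (fun ω => D3 ω ^ 2) ≤ 32 * B := by
    rw [hD3, prodExpect_offdiag_sq hp e he0 (fun i j => if i = j then 0 else A i j)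
      (fun i j => by simp only [eq_comm (a := i), hA i j]) (fun i => by simp)]
    have h1 : ∑ i, ∑ j, (if i = j then 0 else A i j) ^ 2 * (v i * v j)
        ≤ ∑ i, ∑ j, (A i j ^ 2 * v i ^ 2 / 2 + A i j ^ 2 * v j ^ 2 / 2) := by
      refine Finset.sum_le_sum fun i _ => Finset.sum_le_sum fun j _ => ?_
      have h2 : (if i = j then 0 else A i j) ^ 2 ≤ A i j ^ 2 := by
        split_ifs
        · nlinarith [sq_nonneg (A i j)]
        · exact le_rfl
      have h3 := mul_le_mul_of_nonneg_right h2 (mul_nonneg (hv0 i) (hv0 j))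
      nlinarith [mul_nonneg (sq_nonneg (A i j)) (sq_nonneg (v i - v j))]
    have h2 : ∑ i, ∑ j, (A i j ^ 2 * v i ^ 2 / 2 + A i j ^ 2 * v j ^ 2 / 2)
        = ∑ i, A i i * v i ^ 2 := by
      have h3 : ∑ i, ∑ j, A i j ^ 2 * v i ^ 2 / 2 = ∑ i, A i i * v i ^ 2 / 2 :=
        Finset.sum_congr rfl fun i _ => by rw [← Finset.sum_div, ← Finset.sum_mul, hrow]
      have h4 : ∑ i, ∑ j, A i j ^ 2 * v j ^ 2 / 2 = ∑ i, A i i * v i ^ 2 / 2 := by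
        rw [Finset.sum_comm, ← h3]
        refine Finset.sum_congr rfl fun i _ => Finset.sum_congr rfl fun j _ => ?_
        rw [hA j i]
      simp_rw [Finset.sum_add_distrib]
      rw [h3, h4, ← Finset.sum_add_distrib]
      exact Finset.sum_congr rfl fun i _ => by ring
    have h3 : ∑ i, A i i * v i ^ 2 ≤ B4 := Finset.sum_le_sum fun i _ =>
      (mul_le_of_le_one_left (sq_nonneg _) (hAii1 i)).trans (hvb i)
    linarith
  -- `192 = 48 + 48 + 96`, from `(a + b + c)^2 ≤ 3 (a^2 + b^2 + c^2)`, the three bounds above and `1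
  -- ≤ r`.
  have hE : prodExpect p (fun ω => (2 * D1 ω + D2 ω + D3 ω) ^ 2) ≤ 192 * B * r := by
    have h1 : prodExpect p (fun ω => (2 * D1 ω + D2 ω + D3 ω) ^ 2)
        ≤ prodExpect p (fun ω => 12 * D1 ω ^ 2 + 3 * D2 ω ^ 2 + 3 * D3 ω ^ 2) :=
      prodExpect_mono hp fun ω => by
        nlinarith [sq_nonneg (2 * D1 ω - D2 ω), sq_nonneg (2 * D1 ω - D3 ω),
          sq_nonneg (D2 ω - D3 ω)]
    rw [prodExpect_add, prodExpect_add, prodExpect_const_mul, prodExpect_const_mul,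
      prodExpect_const_mul] at h1
    nlinarith [mul_nonneg hBnn (sub_nonneg.2 hr1)]
  have hdecomp : ∀ ω : ∀ i, Ω i, ∑ i, ∑ j, A i j * (Z i (ω i) * Z j (ω j))
      = ∑ i, A i i * v i + ∑ i, m i * g i + (2 * D1 ω + D2 ω + D3 ω) := by
    intro ω
    have h1 : ∑ i, ∑ j, A i j * (e i (ω i) * e j (ω j))
        = D3 ω + ∑ i, A i i * e i (ω i) ^ 2 := by
      have h2 : ∀ i, ∑ j, A i j * (e i (ω i) * e j (ω j))
          = ∑ j, (if i = j then 0 else A i j) * (e i (ω i) * e j (ω j))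
            + A i i * e i (ω i) ^ 2 := by
        intro i
        have h3 : A i i * e i (ω i) ^ 2
            = ∑ j, if i = j then A i j * (e i (ω i) * e j (ω j)) else 0 := by
          simp [sq]
        rw [h3, ← Finset.sum_add_distrib]
        exact Finset.sum_congr rfl fun j _ => by split_ifs <;> ring
      rw [hD3, Finset.sum_congr rfl fun i _ => h2 i, Finset.sum_add_distrib]
    have h2 : D2 ω = ∑ i, A i i * e i (ω i) ^ 2 - ∑ i, A i i * v i := by
      simp only [hD2, mul_sub, Finset.sum_sub_distrib]
    have h3 : ∑ i, ∑ j, A i j * (m i * m j) = ∑ i, m i * g i := by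
      refine Finset.sum_congr rfl fun i _ => ?_
      rw [hg, Finset.mul_sum]
      exact Finset.sum_congr rfl fun j _ => by ring
    have h4 : ∑ i, ∑ j, A i j * (e i (ω i) * m j) = D1 ω := by
      refine Finset.sum_congr rfl fun i _ => ?_
      rw [hg, Finset.sum_mul]
      exact Finset.sum_congr rfl fun j _ => by ring
    have h5 : ∑ i, ∑ j, A i j * (m i * e j (ω j)) = D1 ω := by
      rw [Finset.sum_comm, ← h4]
      refine Finset.sum_congr rfl fun i _ => Finset.sum_congr rfl fun j _ => ?_
      rw [hA j i]; ring
    have h6 : ∑ i, ∑ j, A i j * (Z i (ω i) * Z j (ω j))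
        = ∑ i, ∑ j, A i j * (e i (ω i) * e j (ω j)) + ∑ i, ∑ j, A i j * (m i * m j)
          + ∑ i, ∑ j, A i j * (e i (ω i) * m j) + ∑ i, ∑ j, A i j * (m i * e j (ω j)) := by
      simp_rw [← Finset.sum_add_distrib]
      refine Finset.sum_congr rfl fun i _ => Finset.sum_congr rfl fun j _ => ?_
      simp only [he]; ring
    rw [h6, h1, h3, h4, h5, h2]
    ring
  have hmarkov : prodProb p (fun ω => (∑ i, ∑ j, A i j * (Z i (ω i) * Z j (ω j))) + η ≤
        ∑ i, A i i * v i)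
      ≤ prodExpect p (fun ω => (η ^ 2)⁻¹ * (2 * D1 ω + D2 ω + D3 ω) ^ 2) := by
    -- Chebyshev's inequality; the nonnegative term `∑ m i * g i` is discarded, which only enlarges
    -- the event.
    refine prodProb_le_prodExpect hp (fun ω => by positivity) fun ω hω => ?_
    rw [hdecomp] at hω
    rw [le_inv_mul_iff₀ (by positivity), mul_one]
    have : η ≤ -(2 * D1 ω + D2 ω + D3 ω) := by linarith
    nlinarith
  refine hmarkov.trans ?_
  rw [prodExpect_const_mul, div_eq_inv_mul]
  gcongr

end Product

/-! ### Permutation averages and dose ranges within one matched set -/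

/-- Composition with a cyclic shift by `c` is a bijection of the permutations, and for fixed `σ` the
value `c + σ j` meets each position once. -/
lemma sum_perm_apply {n : ℕ} (hn : 1 ≤ n) (F : Fin n → ℝ) (j : Fin n) :
    (n : ℝ) * ∑ σ : Equiv.Perm (Fin n), F (σ j)
      = Fintype.card (Equiv.Perm (Fin n)) * ∑ k, F k := by
  have : NeZero n := ⟨by omega⟩
  have h1 : ∀ c : Fin n, ∑ σ : Equiv.Perm (Fin n), F (c + σ j)
      = ∑ σ : Equiv.Perm (Fin n), F (σ j) := fun c =>
    Fintype.sum_equiv (Equiv.mulLeft (Equiv.addLeft c)) _ _ fun σ => by simp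
  have h2 : ∑ c : Fin n, ∑ σ : Equiv.Perm (Fin n), F (c + σ j)
      = n * ∑ σ : Equiv.Perm (Fin n), F (σ j) := by
    simp [h1]
  rw [← h2, Finset.sum_comm]
  have h3 : ∀ σ : Equiv.Perm (Fin n), ∑ c, F (c + σ j) = ∑ k, F k := fun σ =>
    Fintype.sum_equiv (Equiv.addRight (σ j)) _ _ fun c => by simp
  simp [h3]

/-- The sum of the upper half minus the sum of the lower half of `z`. -/
noncomputable def halfSpread {n : ℕ} (z : Fin n → ℝ) : ℝ :=
  (∑ k ∈ Finset.univ.filter (fun k : Fin n => (n + 1) / 2 ≤ k.val), z k) -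
    ∑ k ∈ Finset.univ.filter (fun k : Fin n => k.val < n / 2), z k

/-- The two halves have equal size, so the median cancels from their difference; for odd `n` the
middle rank lies in neither half. The left side is a sum over all ranks and hence invariant under
permutations. -/
lemma sum_abs_sub_median {n : ℕ} (hn : 1 ≤ n) {z : Fin n → ℝ} (hz : Monotone z) :
    ∑ k, |z k - z ⟨n / 2, by omega⟩| = halfSpread z := by
  set m := z ⟨n / 2, by omega⟩ with hm
  have h1 : ∀ k : Fin n, |z k - m| = (if (n + 1) / 2 ≤ k.val then z k - m else 0)
      - (if k.val < n / 2 then z k - m else 0) := by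
    intro k
    rcases lt_trichotomy k.val (n / 2) with h | h | h
    · have : z k ≤ m := hz (Fin.mk_le_mk.2 h.le)
      rw [if_neg (by omega), if_pos h, abs_of_nonpos (by linarith)]
      ring
    · have : z k = m := by rw [hm]; congr 1; exact Fin.ext h
      simp [this]
    · have : m ≤ z k := hz (Fin.mk_le_mk.2 h.le)
      rw [if_pos (by omega), if_neg (by omega), abs_of_nonneg (by linarith)]
      ring
  have hcard : (Finset.univ.filter (fun k : Fin n => (n + 1) / 2 ≤ k.val)).card
      = (Finset.univ.filter (fun k : Fin n => k.val < n / 2)).card := by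
    refine Finset.card_bij (fun k _ => Fin.rev k) ?_ (fun _ _ _ _ h => Fin.rev_injective h) ?_
    · intro k hk
      simp only [Finset.mem_filter, Finset.mem_univ, true_and, Fin.val_rev] at hk ⊢
      omega
    · intro k hk
      refine ⟨Fin.rev k, ?_, Fin.rev_rev k⟩
      simp only [Finset.mem_filter, Finset.mem_univ, true_and, Fin.val_rev] at hk ⊢
      omega
  simp_rw [h1, Finset.sum_sub_distrib, ← Finset.sum_filter, Finset.sum_sub_distrib,
    Finset.sum_const, hcard, halfSpread]
  ring

lemma halfSpread_nonneg {n : ℕ} (hn : 1 ≤ n) {z : Fin n → ℝ} (hz : Monotone z) :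
    0 ≤ halfSpread z := by
  rw [← sum_abs_sub_median hn hz]
  exact Finset.sum_nonneg fun _ _ => abs_nonneg _

/-- This bounds probability ratios by `Γ_i^p`. For `x = z (σ j) - z (τ j)` and `0 ≤ u ≤ 1`, `x u ≤
(|x| + x) / 2`, and `|x|` is at most the sum of the distances to the median. On summing, the signed
parts cancel and the distances give twice `halfSpread`. -/
lemma sum_perm_mul_sub_le_halfSpread {n : ℕ} (hn : 1 ≤ n) {z : Fin n → ℝ} (hz : Monotone z)
    {u : Fin n → ℝ} (hu : ∀ j, 0 ≤ u j ∧ u j ≤ 1) (σ τ : Equiv.Perm (Fin n)) :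
    ∑ j, z (σ j) * u j ≤ halfSpread z + ∑ j, z (τ j) * u j := by
  rw [← sum_abs_sub_median hn hz]
  set m := z ⟨n / 2, by omega⟩ with hm
  have h1 : ∀ j, z (σ j) * u j - z (τ j) * u j
      ≤ (|z (σ j) - m| + |z (τ j) - m| + z (σ j) - z (τ j)) / 2 := by
    intro j
    obtain ⟨h0, h1⟩ := hu j
    have hx : z (σ j) - z (τ j) ≤ |z (σ j) - m| + |z (τ j) - m| := by
      linarith [le_abs_self (z (σ j) - m), neg_abs_le (z (τ j) - m)]
    have hy : -(z (σ j) - z (τ j)) ≤ |z (σ j) - m| + |z (τ j) - m| := by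
      linarith [neg_abs_le (z (σ j) - m), le_abs_self (z (τ j) - m)]
    nlinarith [mul_nonneg h0 (sub_nonneg.2 hx), mul_nonneg (sub_nonneg.2 h1) (sub_nonneg.2 hy)]
  have h2 := Finset.sum_le_sum fun j (_ : j ∈ Finset.univ) => h1 j
  rw [← Finset.sum_div, Finset.sum_sub_distrib, Finset.sum_sub_distrib, Finset.sum_add_distrib,
    Finset.sum_add_distrib, Equiv.sum_comp σ (fun k => |z k - m|),
    Equiv.sum_comp τ (fun k => |z k - m|), Equiv.sum_comp σ z, Equiv.sum_comp τ z] at h2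
  linarith

/-- If weights vary by at most the factor `G`, then the correction by
`(G - 1) / (1 + G)` times the absolute value makes a centred variable nonpositive in mean. -/
lemma sum_weight_mul_sub_abs_nonpos {α : Type*} [Fintype α] [Nonempty α] {q X : α → ℝ} {G : ℝ}
    (hG : 1 ≤ G) (hratio : ∀ x y, q x ≤ G * q y) (hX : ∑ x, X x = 0) :
    ∑ x, q x * (X x - (G - 1) / (1 + G) * |X x|) ≤ 0 := by
  obtain ⟨y, hy⟩ := Finite.exists_min q
  have hG1 : 0 < 1 + G := by linarith
  -- With `q y` minimal, one linear function dominates on both sides: for `X x ≥ 0` by the ratio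
  -- bound, for `X x ≤ 0` by minimality. Its sum vanishes.
  have h1 : ∀ x, q x * (X x - (G - 1) / (1 + G) * |X x|) ≤ 2 * G * q y / (1 + G) * X x := by
    intro x
    rcases le_total 0 (X x) with h | h
    · rw [abs_of_nonneg h]
      have e : q x * (X x - (G - 1) / (1 + G) * X x) = 2 * q x / (1 + G) * X x := by
        field_simp; ring
      rw [e]
      refine mul_le_mul_of_nonneg_right ?_ h
      gcongr ?_ / _
      linarith [hratio x y]
    · rw [abs_of_nonpos h]
      have e : q x * (X x - (G - 1) / (1 + G) * -X x) = 2 * G * q x / (1 + G) * X x := by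
        field_simp; ring
      rw [e]
      refine mul_le_mul_of_nonpos_right ?_ h
      gcongr
      exact hy x
  refine (Finset.sum_le_sum fun x _ => h1 x).trans_eq ?_
  rw [← Finset.mul_sum, hX, mul_zero]

/-! ### The dose model as a product law, and the sign of the mean of the corrected statistic -/

namespace DoseStudy

variable (S : DoseStudy)

lemma isProbWeight_setProb (γ : ℝ) (u : S.Confounder) (i : Fin S.I) :
    IsProbWeight (S.setProb γ u i) := by
  constructor
  · intro σ
    unfold setProb
    positivity
  · simp only [setProb, ← Finset.sum_div]
    exact div_self (by positivity)

lemma expect_eq_prodExpect (γ : ℝ) (u : S.Confounder) (g : S.Assignment → ℝ) :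
    S.expect γ u g = prodExpect (S.setProb γ u) g := rfl

lemma probEvent_eq_prodProb (γ : ℝ) (u : S.Confounder) (A : S.Assignment → Prop) :
    S.probEvent γ u A = prodProb (S.setProb γ u) A := rfl

/-- `V_{N,i}` as a function of the permutation of set `i`. -/
noncomputable def permStat (i : Fin S.I) (σ : Equiv.Perm (Fin (S.n i))) : ℝ :=
  ∑ j, S.f i (σ j) (S.z i (σ j)) (S.r i j (S.z i (σ j)))

lemma VNSet_eq (i : Fin S.I) (π : S.Assignment) : S.VNSet i π = S.permStat i (π i) := by
  simp [VNSet, permStat, dose, outcome]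

/-- `V_{C,Γ,θ₀,i}` as a function of the permutation of set `i`. -/
noncomputable def permStatC (γ θ₀ : ℝ) (i : Fin S.I) (σ : Equiv.Perm (Fin (S.n i))) : ℝ :=
  S.permStat i σ - θ₀ - S.kappa γ i * |S.permStat i σ - θ₀|

lemma VCSet_eq (γ θ₀ : ℝ) (i : Fin S.I) (π : S.Assignment) :
    S.VCSet γ θ₀ i π = S.permStatC γ θ₀ i (π i) := by
  simp [VCSet, permStatC, VNSet_eq]

lemma sum_permStat_sub_thetaSet (i : Fin S.I) :
    ∑ σ, (S.permStat i σ - S.thetaSet i) = 0 := by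
  have hn : (S.n i : ℝ) ≠ 0 := by have := S.n_pos i; positivity
  rw [Finset.sum_sub_distrib]
  refine sub_eq_zero.2 (mul_left_cancel₀ hn ?_)
  simp only [permStat]
  rw [Finset.sum_comm, Finset.mul_sum]
  simp_rw [fun j => sum_perm_apply (S.n_pos i) (fun k => S.f i k (S.z i k) (S.r i j (S.z i k))) j]
  rw [← Finset.mul_sum, Finset.sum_const, Finset.card_univ, nsmul_eq_mul, thetaSet]
  field_simp

lemma GammaP_eq (γ : ℝ) (i : Fin S.I) :
    S.GammaP γ i = Real.exp (γ * halfSpread (S.z i)) := rfl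

lemma one_le_GammaP {γ : ℝ} (hγ : 0 ≤ γ) (i : Fin S.I) : 1 ≤ S.GammaP γ i := by
  rw [GammaP_eq, Real.one_le_exp_iff]
  exact mul_nonneg hγ (halfSpread_nonneg (S.n_pos i) (S.z_mono i))

/-- The centring is at `θ_i`, the uniform mean, rather than `θ₀`. The tilting bound applies to the
unnormalized exponentials, whose normalizing constant divides out. -/
lemma weightedMean_permStatC_thetaSet_nonpos {γ : ℝ} (hγ : 0 ≤ γ) {u : S.Confounder}
    (hu : S.Normalized u) (i : Fin S.I) :
    weightedMean (S.setProb γ u i) (S.permStatC γ (S.thetaSet i) i) ≤ 0 := by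
  have h := sum_weight_mul_sub_abs_nonpos
    (q := fun σ : Equiv.Perm (Fin (S.n i)) => Real.exp (γ * ∑ j, S.z i (σ j) * u i j))
    (X := fun σ => S.permStat i σ - S.thetaSet i) (G := S.GammaP γ i)
    (S.one_le_GammaP hγ i)
    (fun σ τ => by
      rw [GammaP_eq, ← Real.exp_add, Real.exp_le_exp, ← mul_add]
      exact mul_le_mul_of_nonneg_left
        (sum_perm_mul_sub_le_halfSpread (S.n_pos i) (S.z_mono i) (hu i) σ τ) hγ)
    (S.sum_permStat_sub_thetaSet i)
  have e : weightedMean (S.setProb γ u i) (S.permStatC γ (S.thetaSet i) i)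
      = (∑ σ : Equiv.Perm (Fin (S.n i)), Real.exp (γ * ∑ j, S.z i (σ j) * u i j) *
          (S.permStat i σ - S.thetaSet i
            - (S.GammaP γ i - 1) / (1 + S.GammaP γ i) * |S.permStat i σ - S.thetaSet i|)) /
        ∑ τ : Equiv.Perm (Fin (S.n i)), Real.exp (γ * ∑ j, S.z i (τ j) * u i j) := by
    rw [weightedMean, Finset.sum_div]
    refine Finset.sum_congr rfl fun σ _ => ?_
    rw [setProb, permStatC, kappa]
    ring
  rw [e]
  exact div_nonpos_of_nonpos_of_nonneg h (by positivity)

lemma expect_VC (γ θ₀ : ℝ) (u : S.Confounder) :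
    S.expect γ u (S.VC γ θ₀)
      = ∑ i, (S.n i : ℝ) / S.N * weightedMean (S.setProb γ u i) (S.permStatC γ θ₀ i) := by
  rw [expect_eq_prodExpect]
  have e : S.VC γ θ₀ = fun π => ∑ i, (S.n i : ℝ) / S.N * S.permStatC γ θ₀ i (π i) := by
    ext π; simp [VC, VCSet_eq]
  rw [e, prodExpect_sum]
  refine Finset.sum_congr rfl fun i _ => ?_
  rw [prodExpect_const_mul]
  exact congrArg _ (prodExpect_eval (S.isProbWeight_setProb γ u) i _)

lemma weightedMean_permStatC (γ θ₀ : ℝ) (u : S.Confounder) (i : Fin S.I) :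
    weightedMean (S.setProb γ u i) (S.permStatC γ θ₀ i)
      = weightedMean (S.setProb γ u i) (S.permStat i) - θ₀
        - S.kappa γ i * S.expect γ u (fun π => |S.VNSet i π - θ₀|) := by
  have h : S.expect γ u (fun π => |S.VNSet i π - θ₀|)
      = weightedMean (S.setProb γ u i) (fun σ => |S.permStat i σ - θ₀|) := by
    simp_rw [VNSet_eq, expect_eq_prodExpect]
    exact prodExpect_eval (S.isProbWeight_setProb γ u) i fun σ => |S.permStat i σ - θ₀|
  rw [h, ← weightedMean.const_mul]
  change weightedMean _ (fun σ => _ - _) = _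
  rw [weightedMean.sub, weightedMean.sub, weightedMean.const (S.isProbWeight_setProb γ u i)]

/-- Under the weak null hypothesis, the condition on the confounders makes the corrected
statistic nonpositive in expectation. -/
theorem expect_VC_nonpos {γ θ₀ : ℝ} (hγ : 0 ≤ γ) (hI : 0 < S.I) (hnull : S.theta = θ₀)
    {u : S.Confounder} (hu : S.ConfounderCondition γ θ₀ u) :
    S.expect γ u (S.VC γ θ₀) ≤ 0 := by
  obtain ⟨u', hu', hle, hcond⟩ := hu
  refine hle.trans ?_
  have hN : (S.N : ℝ) ≠ 0 := by
    have h1 : S.n ⟨0, hI⟩ ≤ S.N := Finset.single_le_sum (f := S.n) (fun _ _ => Nat.zero_le _)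
      (Finset.mem_univ _)
    have h2 := S.n_pos ⟨0, hI⟩
    have : 0 < S.N := by omega
    positivity
  have hw : ∑ i, (S.n i : ℝ) / S.N = 1 := by
    rw [← Finset.sum_div, div_eq_one_iff_eq hN, N, Nat.cast_sum]
  have h0 : ∑ i, (S.n i : ℝ) / S.N *
      weightedMean (S.setProb γ u' i) (S.permStatC γ (S.thetaSet i) i) ≤ 0 :=
    Finset.sum_nonpos fun i _ => mul_nonpos_of_nonneg_of_nonpos (by positivity)
      (S.weightedMean_permStatC_thetaSet_nonpos hγ hu' i)
  rw [expect_VC]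
  -- The weighted `θ_i` sum to `θ = θ₀`, so the two centrings differ only in the absolute-value
  -- terms, which `hcond` compares.
  simp_rw [weightedMean_permStatC, mul_sub, Finset.sum_sub_distrib, ← mul_assoc] at h0 ⊢
  rw [← Finset.sum_mul, hw, one_mul, ← hnull]
  change _ - S.theta - _ ≤ 0 at h0
  linarith

end DoseStudy

/-! ### The residual projection of the regression -/

lemma transpose_one_sub_hatMatrix {I L : ℕ} (Q : Matrix (Fin I) (Fin L) ℝ) :
    (1 - hatMatrix Q).transpose = 1 - hatMatrix Q := by
  simp [hatMatrix, Matrix.transpose_mul, Matrix.transpose_nonsing_inv, Matrix.mul_assoc]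

/-- Full column rank of `Q` enters as invertibility of `Qᵀ Q`. -/
lemma one_sub_hatMatrix_mul_self {I L : ℕ} {Q : Matrix (Fin I) (Fin L) ℝ}
    (hQ : IsUnit (Q.transpose * Q)) :
    (1 - hatMatrix Q) * (1 - hatMatrix Q) = 1 - hatMatrix Q := by
  have h1 : hatMatrix Q * hatMatrix Q = hatMatrix Q := by
    have h2 : (Q.transpose * Q)⁻¹ * (Q.transpose * Q) = 1 :=
      Matrix.nonsing_inv_mul _ ((Matrix.isUnit_iff_isUnit_det _).1 hQ)
    calc hatMatrix Q * hatMatrix Q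
        = Q * ((Q.transpose * Q)⁻¹ * (Q.transpose * Q)) * (Q.transpose * Q)⁻¹ * Q.transpose := by
          simp only [hatMatrix, Matrix.mul_assoc]
      _ = hatMatrix Q := by rw [h2, Matrix.mul_one, hatMatrix]
  rw [Matrix.mul_sub, Matrix.sub_mul, Matrix.sub_mul, h1]
  simp

/-! ### Standardization, the variance estimator and the rejection event -/

namespace DoseStudy

variable (S : DoseStudy)

/-- `w_i V_{C,Γ,θ₀,i}` as a function of the permutation of set `i`. -/
noncomputable def weightedStat (γ θ₀ : ℝ) (i : Fin S.I) (σ : Equiv.Perm (Fin (S.n i))) : ℝ :=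
  S.weight i * S.permStatC γ θ₀ i σ

/-- The deviation of `w_i V_{C,Γ,θ₀,i}` from its mean. -/
noncomputable def centeredStat (γ θ₀ : ℝ) (u : S.Confounder) (i : Fin S.I)
    (σ : Equiv.Perm (Fin (S.n i))) : ℝ :=
  S.weightedStat γ θ₀ i σ - weightedMean (S.setProb γ u i) (S.weightedStat γ θ₀ i)

/-- The variance of `∑ i, w_i V_{C,Γ,θ₀,i}`. -/
noncomputable def totalVariance (γ θ₀ : ℝ) (u : S.Confounder) : ℝ :=
  ∑ i, weightedMean (S.setProb γ u i) (fun σ => S.centeredStat γ θ₀ u i σ ^ 2)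

variable {S}

lemma VC_eq (hI : 0 < S.I) (γ θ₀ : ℝ) (π : S.Assignment) :
    S.VC γ θ₀ π = (S.I : ℝ)⁻¹ * ∑ i, S.weightedStat γ θ₀ i (π i) := by
  have : (S.I : ℝ) ≠ 0 := by positivity
  rw [VC, Finset.mul_sum]
  refine Finset.sum_congr rfl fun i _ => ?_
  rw [VCSet_eq, weightedStat, weight]
  field_simp

lemma VC_sub_expect (hI : 0 < S.I) (γ θ₀ : ℝ) (u : S.Confounder) (π : S.Assignment) :
    S.VC γ θ₀ π - S.expect γ u (S.VC γ θ₀)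
      = (S.I : ℝ)⁻¹ * ∑ i, S.centeredStat γ θ₀ u i (π i) := by
  have h1 : S.expect γ u (S.VC γ θ₀) = (S.I : ℝ)⁻¹ *
      ∑ i, weightedMean (S.setProb γ u i) (S.weightedStat γ θ₀ i) := by
    rw [expect_eq_prodExpect, funext (VC_eq hI γ θ₀), prodExpect_const_mul, prodExpect_sum]
    congr 1
    exact Finset.sum_congr rfl fun i _ => prodExpect_eval (S.isProbWeight_setProb γ u) i _
  rw [h1, VC_eq hI, ← mul_sub, ← Finset.sum_sub_distrib]
  rfl

lemma weightedMean_centeredStat (γ θ₀ : ℝ) (u : S.Confounder) (i : Fin S.I) :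
    weightedMean (S.setProb γ u i) (S.centeredStat γ θ₀ u i) = 0 :=
  weightedMean.sub_self_eq_zero (S.isProbWeight_setProb γ u i) _

lemma variance_VC (hI : 0 < S.I) (γ θ₀ : ℝ) (u : S.Confounder) :
    S.variance γ u (S.VC γ θ₀) = ((S.I : ℝ) ^ 2)⁻¹ * S.totalVariance γ θ₀ u := by
  rw [variance, expect_eq_prodExpect]
  simp_rw [VC_sub_expect hI, mul_pow]
  rw [prodExpect_const_mul, inv_pow]
  congr 1
  exact prodExpect_sum_sq (S.isProbWeight_setProb γ u) (S.centeredStat γ θ₀ u)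
    (weightedMean_centeredStat γ θ₀ u)

namespace MomentRegular

variable {γ θ₀ c C : ℝ} {u : S.Confounder}

lemma le_totalVariance (h : S.MomentRegular γ θ₀ c C u) (hI : 0 < S.I) :
    c * S.I ≤ S.totalVariance γ θ₀ u := by
  have h1 := h.nondegenerate
  have h2 : (0 : ℝ) < S.I := by positivity
  rw [variance_VC hI] at h1
  have h3 := mul_le_mul_of_nonneg_right h1 h2.le
  have h4 : (S.I : ℝ) * (((S.I : ℝ) ^ 2)⁻¹ * S.totalVariance γ θ₀ u) * S.I
      = S.totalVariance γ θ₀ u := by field_simp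
  rwa [h4] at h3

lemma sum_pow_four_le (h : S.MomentRegular γ θ₀ c C u) (hI : 0 < S.I) :
    ∑ i, weightedMean (S.setProb γ u i) (fun σ => S.weightedStat γ θ₀ i σ ^ 4) ≤ C * S.I := by
  have h1 := h.fourth_moment
  rw [inv_mul_le_iff₀ (by positivity), mul_comm] at h1
  refine le_trans (Finset.sum_le_sum fun i _ => ?_) h1
  simp_rw [weightedStat, mul_pow, VCSet_eq]
  rw [weightedMean.const_mul, expect_eq_prodExpect]
  refine le_of_eq (congrArg _ ?_)
  exact (prodExpect_eval (S.isProbWeight_setProb γ u) i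
    fun σ => S.permStatC γ θ₀ i σ ^ 4).symm

end MomentRegular

/-- Absorbing `W` into the variables produces the projection form to which `prodProb_quadForm_le`
applies. -/
lemma varEstC_eq (γ θ₀ : ℝ) {L : ℕ} (Q : Matrix (Fin S.I) (Fin L) ℝ) (π : S.Assignment) :
    S.varEstC γ θ₀ Q π = ((S.I : ℝ) ^ 2)⁻¹ * ∑ i, ∑ j, (1 - hatMatrix Q) i j *
      (S.weightedStat γ θ₀ i (π i) / Real.sqrt (1 - hatMatrix Q i i) *
        (S.weightedStat γ θ₀ j (π j) / Real.sqrt (1 - hatMatrix Q j j))) := by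
  rw [varEstC, dotProduct]
  congr 1
  refine Finset.sum_congr rfl fun i _ => ?_
  rw [Matrix.mulVec, dotProduct, Finset.mul_sum]
  refine Finset.sum_congr rfl fun j _ => ?_
  rw [Matrix.mul_diagonal, Matrix.diagonal_mul, yC, yC, VCSet_eq, VCSet_eq, weightedStat,
    weightedStat]
  ring

/-- The variance estimator is conservative up to a factor close to one, with high probability. -/
lemma prodProb_varEstC_le {γ θ₀ c C δ η : ℝ} {u : S.Confounder}
    (h : S.MomentRegular γ θ₀ c C u) (hI : 0 < S.I) (hc : 0 < c) (hδ : 0 < δ) (hη : 0 < η)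
    {L : ℕ} {Q : Matrix (Fin S.I) (Fin L) ℝ} (hQ : IsUnit (Q.transpose * Q))
    (hlev : ∀ i, hatMatrix Q i i ≤ 1 - δ) :
    prodProb (S.setProb γ u)
        (fun π => (S.I : ℝ) ^ 2 * S.varEstC γ θ₀ Q π ≤ (1 - η) * S.totalVariance γ θ₀ u)
      ≤ 192 * C / (δ ^ 2 * η ^ 2 * c ^ 2) * (Real.sqrt S.I)⁻¹ := by
  have hIr : (0 : ℝ) < S.I := by positivity
  have : Nonempty (Fin S.I) := ⟨⟨0, hI⟩⟩
  have hd : ∀ i, 0 < 1 - hatMatrix Q i i := fun i => by linarith [hlev i]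
  have hV := h.le_totalVariance hI
  set V := S.totalVariance γ θ₀ u with hVdef
  have hV0 : 0 < V := lt_of_lt_of_le (by positivity) hV
  have h4 := h.sum_pow_four_le hI
  have hCI : 0 ≤ C * S.I := le_trans (Finset.sum_nonneg fun i _ =>
    weightedMean.nonneg (S.isProbWeight_setProb γ u i) fun x => by positivity) h4
  have hC : 0 ≤ C := nonneg_of_mul_nonneg_left hCI hIr
  have hB : ∑ i, weightedMean (S.setProb γ u i)
      (fun σ => (S.weightedStat γ θ₀ i σ / Real.sqrt (1 - hatMatrix Q i i)) ^ 4)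
      ≤ (δ ^ 2)⁻¹ * (C * S.I) := by
    refine le_trans ?_ (mul_le_mul_of_nonneg_left h4 (by positivity))
    rw [Finset.mul_sum]
    refine Finset.sum_le_sum fun i _ => ?_
    rw [← weightedMean.const_mul]
    refine weightedMean.mono (S.isProbWeight_setProb γ u i) fun σ => ?_
    have e : Real.sqrt (1 - hatMatrix Q i i) ^ 4 = (1 - hatMatrix Q i i) ^ 2 := by
      rw [show (4 : ℕ) = 2 * 2 from rfl, pow_mul, Real.sq_sqrt (hd i).le]
    rw [div_pow, e, div_eq_inv_mul]
    have : δ ≤ 1 - hatMatrix Q i i := by linarith [hlev i]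
    gcongr
  have key := prodProb_quadForm_le (S.isProbWeight_setProb γ u) (1 - hatMatrix Q)
    (transpose_one_sub_hatMatrix Q) (one_sub_hatMatrix_mul_self hQ)
    (fun i σ => S.weightedStat γ θ₀ i σ / Real.sqrt (1 - hatMatrix Q i i)) hB
    (mul_pos hη hV0)
  -- The factor `1 / (1 - h_ii)` from the rescaling cancels the diagonal entry, leaving exactly `V`.
  have hvar : ∑ i, (1 - hatMatrix Q) i i * weightedMean (S.setProb γ u i)
      (fun σ => (S.weightedStat γ θ₀ i σ / Real.sqrt (1 - hatMatrix Q i i)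
        - weightedMean (S.setProb γ u i)
          (fun σ => S.weightedStat γ θ₀ i σ / Real.sqrt (1 - hatMatrix Q i i))) ^ 2) = V := by
    refine Finset.sum_congr rfl fun i _ => ?_
    have e1 : weightedMean (S.setProb γ u i)
        (fun σ => S.weightedStat γ θ₀ i σ / Real.sqrt (1 - hatMatrix Q i i))
        = (Real.sqrt (1 - hatMatrix Q i i))⁻¹ *
          weightedMean (S.setProb γ u i) (S.weightedStat γ θ₀ i) := by
      rw [← weightedMean.const_mul]
      simp_rw [div_eq_inv_mul]
    rw [e1, ← weightedMean.const_mul]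
    congr 1
    ext σ
    have e2 : S.weightedStat γ θ₀ i σ / Real.sqrt (1 - hatMatrix Q i i)
        - (Real.sqrt (1 - hatMatrix Q i i))⁻¹ *
          weightedMean (S.setProb γ u i) (S.weightedStat γ θ₀ i)
        = (Real.sqrt (1 - hatMatrix Q i i))⁻¹ * S.centeredStat γ θ₀ u i σ := by
      rw [centeredStat]; ring
    rw [e2, mul_pow, inv_pow, Real.sq_sqrt (hd i).le, Matrix.sub_apply, Matrix.one_apply_eq,
      mul_inv_cancel_left₀ (hd i).ne']
  rw [hvar] at key
  have hev : (fun π : S.Assignment =>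
        (S.I : ℝ) ^ 2 * S.varEstC γ θ₀ Q π ≤ (1 - η) * V)
      = fun π => (∑ i, ∑ j, (1 - hatMatrix Q) i j *
        (S.weightedStat γ θ₀ i (π i) / Real.sqrt (1 - hatMatrix Q i i) *
        (S.weightedStat γ θ₀ j (π j) / Real.sqrt (1 - hatMatrix Q j j)))) + η * V ≤ V := by
    ext π
    rw [varEstC_eq, mul_inv_cancel_left₀ (by positivity)]
    constructor <;> intro hh <;> linarith
  rw [hev]
  refine key.trans ?_
  rw [Fintype.card_fin]
  -- The fourth-moment bound is linear in `I` and `V ≥ c I`, so the rate is `I^{3/2} / I^2`.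
  calc 192 * ((δ ^ 2)⁻¹ * (C * S.I)) * Real.sqrt S.I / (η * V) ^ 2
      ≤ 192 * ((δ ^ 2)⁻¹ * (C * S.I)) * Real.sqrt S.I / (η * (c * S.I)) ^ 2 := by gcongr
    _ = 192 * C / (δ ^ 2 * η ^ 2 * c ^ 2) * (Real.sqrt S.I / S.I) := by field_simp
    _ = _ := by rw [Real.sqrt_div_self', one_div]

lemma sum_standardized_pow_four_le {γ θ₀ c C : ℝ} {u : S.Confounder}
    (h : S.MomentRegular γ θ₀ c C u) (hI : 0 < S.I) (hc : 0 < c) :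
    ∑ i, weightedMean (S.setProb γ u i)
        (fun σ => (S.centeredStat γ θ₀ u i σ / Real.sqrt (S.totalVariance γ θ₀ u)) ^ 4)
      ≤ 16 * C / c ^ 2 * (S.I : ℝ)⁻¹ := by
  have hIr : (0 : ℝ) < S.I := by positivity
  have hV := h.le_totalVariance hI
  set V := S.totalVariance γ θ₀ u with hVdef
  have hV0 : 0 < V := lt_of_lt_of_le (by positivity) hV
  have h4 := h.sum_pow_four_le hI
  have hCI : 0 ≤ C * S.I := le_trans (Finset.sum_nonneg fun i _ =>
    weightedMean.nonneg (S.isProbWeight_setProb γ u i) fun x => by positivity) h4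
  have e : Real.sqrt V ^ 4 = V ^ 2 := by
    rw [show (4 : ℕ) = 2 * 2 from rfl, pow_mul, Real.sq_sqrt hV0.le]
  simp_rw [div_pow, e, div_eq_inv_mul]
  simp_rw [weightedMean.const_mul]
  rw [← Finset.mul_sum]
  calc (V ^ 2)⁻¹ * ∑ i, weightedMean (S.setProb γ u i) (fun σ => S.centeredStat γ θ₀ u i σ ^ 4)
      ≤ (V ^ 2)⁻¹ * (16 * (C * S.I)) := by
        gcongr
        refine le_trans ?_ (mul_le_mul_of_nonneg_left h4 (by norm_num))
        rw [Finset.mul_sum]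
        exact Finset.sum_le_sum fun i _ =>
          weightedMean.centered_pow_four_le (S.isProbWeight_setProb γ u i) _
    _ ≤ ((c * S.I) ^ 2)⁻¹ * (16 * (C * S.I)) := by gcongr
    _ = _ := by field_simp

lemma sum_standardized_sq {γ θ₀ : ℝ} {u : S.Confounder} (hV : 0 < S.totalVariance γ θ₀ u) :
    ∑ i, weightedMean (S.setProb γ u i)
        (fun σ => (S.centeredStat γ θ₀ u i σ / Real.sqrt (S.totalVariance γ θ₀ u)) ^ 2) = 1 := by
  simp_rw [div_pow, Real.sq_sqrt hV.le, div_eq_inv_mul]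
  simp_rw [weightedMean.const_mul]
  rw [← Finset.mul_sum]
  exact inv_mul_cancel₀ hV.ne'

/-- Rejection forces a large standardized sum, unless the variance estimate is small. -/
lemma le_sum_standardized_of_pValueC_le {γ θ₀ η z α : ℝ} {u : S.Confounder} (hI : 0 < S.I)
    (hmean : S.expect γ u (S.VC γ θ₀) ≤ 0) (hV : 0 < S.totalVariance γ θ₀ u) (hη1 : η < 1)
    (hz : 0 ≤ z) (hzα : stdNormalCdf z = 1 - α)
    {L : ℕ} {Q : Matrix (Fin S.I) (Fin L) ℝ} {π : S.Assignment}
    (hπ : S.pValueC γ θ₀ Q π ≤ α)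
    (hS : (1 - η) * S.totalVariance γ θ₀ u < (S.I : ℝ) ^ 2 * S.varEstC γ θ₀ Q π) :
    z * Real.sqrt (1 - η) ≤
      ∑ i, S.centeredStat γ θ₀ u i (π i) / Real.sqrt (S.totalVariance γ θ₀ u) := by
  have hIr : (0 : ℝ) < S.I := by positivity
  set V := S.totalVariance γ θ₀ u with hVdef
  -- Positivity excludes the convention `x / 0 = 0`, under which a vanishing estimate would reject
  -- at `α = 1 / 2`; that case belongs to the exceptional event.
  have hS0 : 0 < S.varEstC γ θ₀ Q π := by
    refine pos_of_mul_pos_right (lt_trans ?_ hS) (by positivity)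
    exact mul_pos (by linarith) hV
  have h1 : z ≤ S.VC γ θ₀ π / Real.sqrt (S.varEstC γ θ₀ Q π) := by
    rw [← strictMono_stdNormalCdf.le_iff_le, hzα]
    unfold pValueC at hπ
    change 1 - stdNormalCdf _ ≤ α at hπ
    linarith
  rw [le_div_iff₀ (Real.sqrt_pos.2 hS0)] at h1
  rw [← Finset.sum_div, le_div_iff₀ (Real.sqrt_pos.2 hV)]
  have h2 : Real.sqrt (1 - η) * Real.sqrt V ≤ S.I * Real.sqrt (S.varEstC γ θ₀ Q π) := by
    rw [← Real.sqrt_mul (by linarith)]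
    refine Real.sqrt_le_iff.2 ⟨by positivity, ?_⟩
    rw [mul_pow, Real.sq_sqrt hS0.le]
    exact hS.le
  have h3 := VC_sub_expect hI γ θ₀ u π
  have h4 : ∑ i, S.centeredStat γ θ₀ u i (π i)
      = S.I * (S.VC γ θ₀ π - S.expect γ u (S.VC γ θ₀)) := by
    rw [h3, mul_inv_cancel_left₀ hIr.ne']
  rw [h4]
  calc z * Real.sqrt (1 - η) * Real.sqrt V
      = z * (Real.sqrt (1 - η) * Real.sqrt V) := by ring
    _ ≤ z * (S.I * Real.sqrt (S.varEstC γ θ₀ Q π)) := by gcongr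
    _ = S.I * (z * Real.sqrt (S.varEstC γ θ₀ Q π)) := by ring
    _ ≤ S.I * (S.VC γ θ₀ π - S.expect γ u (S.VC γ θ₀)) := by
        gcongr
        linarith

end DoseStudy

/-! ### Combination of the bounds -/

theorem mainTheorem4
    (S : ℕ → DoseStudy)
    (hI : Filter.Tendsto (fun m => (S m).I) Filter.atTop Filter.atTop)
    (γ : ℝ) (hγ : 0 ≤ γ)
    (θ₀ : ℝ) (hnull : ∀ m, (S m).theta = θ₀)
    (L : ℕ → ℕ) (hL : ∀ m, L m < (S m).I)
    (Q : (m : ℕ) → Matrix (Fin (S m).I) (Fin (L m)) ℝ)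
    (hQ : ∀ m, IsUnit ((Q m).transpose * Q m))
    (δ : ℝ) (hδ : 0 < δ) (hlev : ∀ m i, hatMatrix (Q m) i i ≤ 1 - δ)
    (c C : ℝ) (hc : 0 < c)
    (α : ℝ) (hα0 : 0 < α) (hα : α ≤ 1 / 2) :
    ∀ ε : ℝ, 0 < ε → ∀ᶠ m in Filter.atTop,
      ∀ u : (S m).Confounder, (S m).Normalized u →
        (S m).ConfounderCondition γ θ₀ u →
        (S m).MomentRegular γ θ₀ c C u →
        (S m).probEvent γ u (fun π => (S m).pValueC γ θ₀ (Q m) π ≤ α) ≤ α + ε := by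
  intro ε hε
  obtain ⟨z, hz, hzα⟩ := exists_nonneg_stdNormalCdf_eq hα0 hα
  -- The slack `η` in the variance is chosen so that lowering the threshold to `z √(1 - η)` costs at
  -- most `ε / 4`.
  obtain ⟨η, hη0, hη1, hηz⟩ : ∃ η : ℝ, 0 < η ∧ η < 1 ∧
      stdNormalCdf z - ε / 4 < stdNormalCdf (z * Real.sqrt (1 - η)) := by
    have hcont : Continuous fun η : ℝ => stdNormalCdf (z * Real.sqrt (1 - η)) :=
      continuous_stdNormalCdf.comp (by fun_prop)
    have h0 : stdNormalCdf z - ε / 4 < stdNormalCdf (z * Real.sqrt (1 - 0)) := by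
      simp only [sub_zero, Real.sqrt_one, mul_one]
      linarith
    have h1 : ∀ᶠ η in 𝓝[>] (0 : ℝ),
        stdNormalCdf z - ε / 4 < stdNormalCdf (z * Real.sqrt (1 - η)) :=
      (hcont.tendsto 0).mono_left nhdsWithin_le_nhds (lt_mem_nhds h0)
    obtain ⟨η, h2, h3⟩ := (h1.and (Ioo_mem_nhdsGT zero_lt_one)).exists
    exact ⟨η, h3.1, h3.2, h2⟩
  obtain ⟨κ, hκ, hclt⟩ := exists_prodProb_sum_ge_le (z * Real.sqrt (1 - η))
    (show 0 < ε / 4 by linarith)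
  have hIr : Tendsto (fun m => ((S m).I : ℝ)) atTop atTop :=
    tendsto_natCast_atTop_atTop.comp hI
  have hlim1 : Tendsto (fun m => 16 * C / c ^ 2 * ((S m).I : ℝ)⁻¹) atTop (𝓝 0) := by
    have h := (tendsto_inv_atTop_zero.comp hIr).const_mul (16 * C / c ^ 2)
    rwa [mul_zero] at h
  have hlim2 : Tendsto (fun m => 192 * C / (δ ^ 2 * η ^ 2 * c ^ 2) *
      (Real.sqrt (S m).I)⁻¹) atTop (𝓝 0) := by
    have h := (tendsto_inv_atTop_zero.comp (Real.tendsto_sqrt_atTop.comp hIr)).const_mul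
      (192 * C / (δ ^ 2 * η ^ 2 * c ^ 2))
    rwa [mul_zero] at h
  -- How late a study must be depends only on its `I`; `u` is introduced afterwards, which gives
  -- uniformity.
  filter_upwards [hlim1.eventually_le_const hκ,
    hlim2.eventually_le_const (show 0 < ε / 4 by linarith), hI.eventually_gt_atTop 0]
    with m hm1 hm2 hm0 u _ hcond hreg
  have hp := (S m).isProbWeight_setProb γ u
  have hV : 0 < (S m).totalVariance γ θ₀ u :=
    lt_of_lt_of_le (by positivity) (hreg.le_totalVariance hm0)
  have hmean := (S m).expect_VC_nonpos hγ hm0 (hnull m) hcond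
  have h1 := hclt ((S m).setProb γ u)
    (fun i σ => (S m).centeredStat γ θ₀ u i σ / Real.sqrt ((S m).totalVariance γ θ₀ u)) hp
    (fun i => by
      simp_rw [div_eq_inv_mul]
      rw [weightedMean.const_mul, DoseStudy.weightedMean_centeredStat, mul_zero])
    (DoseStudy.sum_standardized_sq hV)
    ((DoseStudy.sum_standardized_pow_four_le hreg hm0 hc).trans hm1)
  have h2 := (DoseStudy.prodProb_varEstC_le hreg hm0 hc hδ hη0 (hQ m) (hlev m)).trans hm2
  rw [DoseStudy.probEvent_eq_prodProb]
  -- The threshold shift, the central limit theorem and the variance event cost `ε / 4` each.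
  refine (prodProb_le_add hp fun π hπ => ?_).trans (add_le_add h1 h2 |>.trans (by linarith))
  by_cases hS : ((S m).I : ℝ) ^ 2 * (S m).varEstC γ θ₀ (Q m) π
      ≤ (1 - η) * (S m).totalVariance γ θ₀ u
  · exact Or.inr hS
  · exact Or.inl (DoseStudy.le_sum_standardized_of_pValueC_le hm0 hmean hV hη1 hz hzα hπ
      (not_le.1 hS))
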